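/- All languages are computable. A computable $\Sigma_1$ formula $\varphi(\bar x)$ is a computably enumerable disjunction of formulas $\exists\bar u\,\theta(\bar x,\bar u)$ with $\theta$ finitary and quantifier-free. For a structure $\mathcal B$, a relation $R\subseteq(\mathcal B^{<\omega})^k$ has a generalized computable $\Sigma_1$ definition (with parameters $\bar b$) if there is a computable sequence of computable $\Sigma_1$ formulas $\varphi_{n_1,\dots,n_k}$ such that $\varphi_{n_1,\dots,n_k}(\bar b,\bar x_1,\dots,\bar x_k)$ defines the restriction of $R$ to tuples $\bar x_j$ of length $n_j$. A relational structure $\mathcal A$, with basic relations $R_i$ of arity $k_i$, is effectively interpreted in $\mathcal B$ with parameters $\bar b$ if there are $D\subseteq\mathcal B^{<\omega}$, an equivalence relation $\equiv$ on $D$ and $\equiv$-invariant relations $R_i^*\subseteq D^{k_i}$ with $(D,(R_i^*)_i)/{\equiv}\;\cong\mathcal A$ such that $D$, $\equiv$, its complement in $D^2$, and (uniformly in $i$) $R_i^*$ and its complement in $D^{k_i}$ are defined by a computable sequence of generalized computable $\Sigma_1$ formulas with parameters $\bar b$. It is effectively interpreted in $\mathcal B$ (without parameters) if this holds with $\bar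 b$ the empty tuple. **Proposition.** Suppose that $\mathcal A$ has an effective interpretation in $\mathcal B$ with a finite tuple of parameters $\bar b$. For $\bar c$ in the orbit of $\bar b$ under $\mathrm{Aut}(\mathcal B)$, let $\mathcal A_{\bar c}$ be the copy of $\mathcal A$ obtained by replacing $\bar b$ by $\bar c$ in the defining formulas, with domain $D_{\bar c}/{\equiv_{\bar c}}$. Assume: 1. the orbit of $\bar b$ is defined by a computable $\Sigma_1$ formula (without parameters); 2. there is a relation $F$ of quadruples of finite tuples of $\mathcal B$, with a generalized computable $\Sigma_1$ definition without parameters, such that for all $\bar c,\bar d$ in the orbit of $\bar b$, the set of pairs $(\bar x,\bar y)\in D_{\bar c}\times D_{\bar d}$ with $(\bar c,\bar d,\bar x,\bar y)\in F$ is invariant under $\equiv_{\bar c}$ on $\bar x$ and under $\equiv_{\bar d}$ on $\bar y$, and defines an isomorphism $f_{\bar c,\bar d}$ from $\mathcal A_{\bar c}$ onto $\mathcal A_{\bar d}$, that is, $f_{\bar c,\bar d}([\bar x])=[\bar y]$ if and only if $(\bar c,\bar d,\bar x,\bar y)\in F$; 3. $f_{\bar c,\bar c}=\mathrm{id}$ and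 $f_{\bar d,\bar e}\circ f_{\bar c,\bar d}=f_{\bar c,\bar e}$ for all $\bar c,\bar d,\bar e$ in the orbit of $\bar b$. Then $\mathcal A$ is effectively interpreted in $\mathcal B$ without parameters. -/

import Mathlib

open FirstOrder FirstOrder.Language

universe u₁ v₁ u₂ v₂ w₁ w₂

namespace EffInt

/-- A computable language: the function symbols and the relation symbols carry (Goedel) numberings
from which the arity of a symbol can be computed. -/
class ComputableLanguage (L : FirstOrder.Language.{u₁, v₁}) where
  [primFunctions : Primcodable (Σ n, L.Functions n)]
  [primRelations : Primcodable (Σ n, L.Relations n)]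
  arityFunctions : Computable (fun f : Σ n, L.Functions n => f.1)
  arityRelations : Computable (fun R : Σ n, L.Relations n => R.1)

attribute [reducible, instance] ComputableLanguage.primFunctions ComputableLanguage.primRelations

/-- Codes of formulas `θ(x₀, …, x_{N-1})`: the number `N`, followed by a word in Polish notation
whose letters are (codes of) terms, relation symbols and natural numbers. -/
abbrev FormulaCode (L : FirstOrder.Language.{u₁, v₁}) : Type (max u₁ v₁) :=
  ℕ × List ((ℕ × List (ℕ ⊕ (Σ i, L.Functions i))) ⊕ ((Σ n, L.Relations n) ⊕ ℕ))

/-- The code of a term in the variables `x₀, …, x_{N-1}` and `k` further (bound) variables, which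
are numbered from `N` on. -/
def termCode {L : FirstOrder.Language.{u₁, v₁}} (N : ℕ) (t : Σ k, L.Term (Fin N ⊕ Fin k)) :
    ℕ × List (ℕ ⊕ (Σ i, L.Functions i)) :=
  (t.1, (t.2.relabel (Sum.elim (fun i : Fin N => (i : ℕ)) (fun j : Fin t.1 => N + (j : ℕ)))).listEncode)

/-- The Goedel number of a formula `θ(x₀, …, x_{N-1})`, built on Mathlib's encoding of formulas as
words (`BoundedFormula.listEncode`). -/
def formulaCode {L : FirstOrder.Language.{u₁, v₁}} (φ : Σ N, L.Formula (Fin N)) : FormulaCode L :=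
  (φ.1, (BoundedFormula.listEncode φ.2).map (Sum.map (termCode φ.1) id))

theorem relabel_injective {L : FirstOrder.Language.{u₁, v₁}} {α β : Type} {g : α → β}
    (hg : Function.Injective g) :
    Function.Injective (Term.relabel g : L.Term α → L.Term β) := by
  intro t
  induction t with
  | var a =>
    intro s h
    cases s with
    | var b => simp only [Term.relabel, Term.var.injEq] at h; rw [hg h]
    | func f ts => simp [Term.relabel] at h
  | func f ts ih =>
    intro s h
    cases s with
    | var b => simp [Term.relabel] at h
    | func f' ts' =>
      simp only [Term.relabel, Term.func.injEq] at h
      obtain ⟨rfl, h1, h2⟩ := h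
      cases h1
      congr 1
      funext i
      exact ih i (congrFun (eq_of_heq h2) i)

theorem termCode_injective {L : FirstOrder.Language.{u₁, v₁}} (N : ℕ) :
    Function.Injective (termCode (L := L) N) := by
  rintro ⟨k, t⟩ ⟨k', t'⟩ h
  simp only [termCode, Prod.mk.injEq] at h
  obtain ⟨rfl, h⟩ := h
  have hinj : Function.Injective
      (Sum.elim (fun i => (i : ℕ)) (fun j => N + (j : ℕ)) : Fin N ⊕ Fin k → ℕ) := by
    rintro (a | a) (b | b) hab
    · simp only [Sum.elim_inl] at hab; rw [Fin.ext hab]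
    · have := a.2; simp only [Sum.elim_inl, Sum.elim_inr] at hab; omega
    · have := b.2; simp only [Sum.elim_inl, Sum.elim_inr] at hab; omega
    · simp only [Sum.elim_inr] at hab; rw [Fin.ext (by omega : (a : ℕ) = b)]
  rw [relabel_injective hinj (Term.listEncode_injective h)]

/-- Distinct formulas have distinct codes. -/
theorem formulaCode_injective {L : FirstOrder.Language.{u₁, v₁}} :
    Function.Injective (formulaCode (L := L)) := by
  rintro ⟨N, φ⟩ ⟨N', φ'⟩ h
  simp only [formulaCode, Prod.mk.injEq] at h
  obtain ⟨rfl, h⟩ := h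
  have h2 := List.map_injective_iff.2
    (Sum.map_injective.2 ⟨termCode_injective N, Function.injective_id⟩) h
  have h3 := BoundedFormula.listEncode_sigma_injective (L := L) (α := Fin N)
    (a₁ := ⟨0, φ⟩) (a₂ := ⟨0, φ'⟩) h2
  simpa using h3

/-- A computable sequence `(φ_i)`, `i ∈ ι`, of computable `Σ₁` formulas, `φ_i` having the free
variables `x₀, …, x_{ar i - 1}`.  Each `φ_i` is a computably enumerable disjunction of formulas
`∃ x_{ar i} ⋯ ∃ x_{N-1} θ(x₀, …, x_{N-1})` with `θ` finitary and quantifier-free; such a disjunct is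
given by the pair `⟨N, θ⟩`, and `disj i` is the set of disjuncts of `φ_i`.  The disjuncts are
computably enumerable uniformly in `i`. -/
structure SigmaOneSeq (L : FirstOrder.Language.{u₁, v₁}) [ComputableLanguage L] (ι : Type w₁) [Primcodable ι]
    (ar : ι → ℕ) where
  disj : ι → Set (Σ N, L.Formula (Fin N))
  ar_le : ∀ i, ∀ θ ∈ disj i, ar i ≤ θ.1
  isQF : ∀ i, ∀ θ ∈ disj i, BoundedFormula.IsQF θ.2
  ce : REPred (fun z : ι × FormulaCode L => ∃ θ ∈ disj z.1, formulaCode θ = z.2)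

/-- The tuple `x̄ ∈ B^{ar i}` satisfies `φ_i`: for some disjunct `⟨N, θ⟩`, the tuple can be extended
to an `N`-tuple which satisfies `θ`. -/
def SigmaOneSeq.Realize {L : FirstOrder.Language.{u₁, v₁}} [ComputableLanguage L] {ι : Type w₁} [Primcodable ι]
    {ar : ι → ℕ} (Φ : SigmaOneSeq L ι ar) {B : Type w₂} [L.Structure B] (i : ι) (x : List B) :
    Prop :=
  x.length = ar i ∧
    ∃ θ ∈ Φ.disj i, ∃ v : Fin θ.1 → B, x <+: List.ofFn v ∧ Formula.Realize θ.2 v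

/-- A computable `Σ₁` formula in `p` free variables. -/
abbrev SigmaOneFormula (L : FirstOrder.Language.{u₁, v₁}) [ComputableLanguage L] (p : ℕ) :=
  SigmaOneSeq L Unit (fun _ => p)

/-- A computable sequence, indexed by `ι`, of generalized computable `Σ₁` formulas with `p`
parameters.  A generalized formula `ψ(ū; x̄₁, …, x̄_k)`, whose variables `x̄_j` range over the tuples
of arbitrary finite length, is the sequence of its instances
`ψ_{n₁, …, n_k}(ū; x̄₁, …, x̄_k)` for `x̄_j` of length `n_j`; the instance is indexed by the list
`[n₁, …, n_k]` and has arity `p + n₁ + ⋯ + n_k`. -/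
abbrev GenSigmaOneSeq (L : FirstOrder.Language.{u₁, v₁}) [ComputableLanguage L] (ι : Type w₁) [Primcodable ι]
    (p : ℕ) :=
  SigmaOneSeq L (ι × List ℕ) (fun s => p + s.2.sum)

/-- The `i`-th generalized formula holds of the tuples `x̄₁, …, x̄_k` with parameters `c̄`. -/
def GenHolds {L : FirstOrder.Language.{u₁, v₁}} [ComputableLanguage L] {ι : Type w₁} [Primcodable ι] {p : ℕ}
    (Φ : GenSigmaOneSeq L ι p) {B : Type w₂} [L.Structure B] (i : ι) (c : Fin p → B)
    (xs : List (List B)) : Prop :=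
  Φ.Realize (i, xs.map List.length) (List.ofFn c ++ xs.flatten)

/-- The formulas of a would-be effective interpretation, with `p` parameters, of a structure for the
relational language `LA` in a structure for `LB`: generalized computable `Σ₁` formulas for the
domain, for `≡` and its complement, and (uniformly in the symbol `R`) for `R*` and its
complement. -/
structure InterpFormulas (LA : FirstOrder.Language.{u₁, v₁}) (LB : FirstOrder.Language.{u₂, v₂}) [ComputableLanguage LA]
    [ComputableLanguage LB] (p : ℕ) where
  dom : GenSigmaOneSeq LB Unit p
  eqv : GenSigmaOneSeq LB Unit p
  neqv : GenSigmaOneSeq LB Unit p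
  rel : GenSigmaOneSeq LB (Σ n, LA.Relations n) p
  nrel : GenSigmaOneSeq LB (Σ n, LA.Relations n) p

namespace InterpFormulas

variable {LA : FirstOrder.Language.{u₁, v₁}} {LB : FirstOrder.Language.{u₂, v₂}} [ComputableLanguage LA]
  [ComputableLanguage LB] {p : ℕ} {B : Type w₂} [LB.Structure B]

/-- The set `D_c̄` of finite tuples. -/
def D (Φ : InterpFormulas LA LB p) (c : Fin p → B) : Set (List B) :=
  {x | GenHolds Φ.dom () c [x]}

/-- The relation `≡_c̄`. -/
def Eqv (Φ : InterpFormulas LA LB p) (c : Fin p → B) (x y : List B) : Prop :=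
  GenHolds Φ.eqv () c [x, y]

/-- The relation defined by the formula for the complement of `≡_c̄`. -/
def Neqv (Φ : InterpFormulas LA LB p) (c : Fin p → B) (x y : List B) : Prop :=
  GenHolds Φ.neqv () c [x, y]

/-- The relation `R*`. -/
def Rel (Φ : InterpFormulas LA LB p) (c : Fin p → B) {n : ℕ} (R : LA.Relations n)
    (xs : Fin n → List B) : Prop :=
  GenHolds Φ.rel ⟨n, R⟩ c (List.ofFn xs)

/-- The relation defined by the formula for the complement of `R*`. -/
def Nrel (Φ : InterpFormulas LA LB p) (c : Fin p → B) {n : ℕ} (R : LA.Relations n)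
    (xs : Fin n → List B) : Prop :=
  GenHolds Φ.nrel ⟨n, R⟩ c (List.ofFn xs)

/-- The universe `D_c̄ / ≡_c̄` of the structure defined by the formulas with parameters `c̄`. -/
def Model (Φ : InterpFormulas LA LB p) (c : Fin p → B) : Type w₂ :=
  Quot (fun x y : Φ.D c => Φ.Eqv c x y)

/-- The class of a tuple of `D_c̄`. -/
def cls (Φ : InterpFormulas LA LB p) (c : Fin p → B) (x : Φ.D c) : Φ.Model c :=
  Quot.mk _ x

/-- The quotient structure `(D_c̄, (R*)) / ≡_c̄`. -/
instance modelStructure [LA.IsRelational] (Φ : InterpFormulas LA LB p) (c : Fin p → B) :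
    LA.Structure (Φ.Model c) where
  funMap f _ := isEmptyElim f
  RelMap R q := ∃ xs : Fin _ → Φ.D c, (∀ j, Φ.cls c (xs j) = q j) ∧ Φ.Rel c R (fun j => xs j)

/-- The formulas, with the parameters `c̄`, form an effective interpretation of `A` in `B`: `≡` is an
equivalence relation on `D` and the `R*` are relations on `D` which are invariant under `≡`; the
complementary formulas define the complements in `D²` and in `D^k`; and
`(D, (R*)) / ≡` is isomorphic to `A`. -/
structure Interprets [LA.IsRelational] (Φ : InterpFormulas LA LB p) (c : Fin p → B)
    (A : Type w₁) [LA.Structure A] : Prop where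
  eqv_dom : ∀ x y, Φ.Eqv c x y → x ∈ Φ.D c ∧ y ∈ Φ.D c
  eqv_equivalence : Equivalence (fun x y : Φ.D c => Φ.Eqv c x y)
  neqv_iff : ∀ x y, Φ.Neqv c x y ↔ x ∈ Φ.D c ∧ y ∈ Φ.D c ∧ ¬ Φ.Eqv c x y
  rel_dom : ∀ {n : ℕ} (R : LA.Relations n) (xs : Fin n → List B),
    Φ.Rel c R xs → ∀ j, xs j ∈ Φ.D c
  rel_invariant : ∀ {n : ℕ} (R : LA.Relations n) (xs ys : Fin n → List B),
    (∀ j, Φ.Eqv c (xs j) (ys j)) → (Φ.Rel c R xs ↔ Φ.Rel c R ys)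
  nrel_iff : ∀ {n : ℕ} (R : LA.Relations n) (xs : Fin n → List B),
    Φ.Nrel c R xs ↔ (∀ j, xs j ∈ Φ.D c) ∧ ¬ Φ.Rel c R xs
  iso : Nonempty (Φ.Model c ≃[LA] A)

end InterpFormulas

/-- `A` is effectively interpreted in `B`, without parameters. -/
def EffectivelyInterpreted (LA : FirstOrder.Language.{u₁, v₁}) (LB : FirstOrder.Language.{u₂, v₂}) [LA.IsRelational]
    [ComputableLanguage LA] [ComputableLanguage LB] (A : Type w₁) [LA.Structure A]
    (B : Type w₂) [LB.Structure B] : Prop :=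
  ∃ Φ : InterpFormulas LA LB 0, Φ.Interprets (Fin.elim0 : Fin 0 → B) A

/-- The orbit of a tuple under the automorphism group. -/
def orbit (L : FirstOrder.Language.{u₂, v₂}) {B : Type w₂} [L.Structure B] {p : ℕ} (b : Fin p → B) :
    Set (Fin p → B) :=
  {c | ∃ σ : B ≃[L] B, c = σ ∘ b}

/-- The quaternary relation `(c̄, d̄, x̄, ȳ) ∈ F` defined by a generalized computable `Σ₁` formula
without parameters. -/
def quaternary {L : FirstOrder.Language.{u₂, v₂}} [ComputableLanguage L] {B : Type w₂} [L.Structure B] {p : ℕ}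
    (F : GenSigmaOneSeq L Unit 0) (c d : Fin p → B) (x y : List B) : Prop :=
  GenHolds F () (Fin.elim0 : Fin 0 → B) [List.ofFn c, List.ofFn d, x, y]

end EffInt

/-! All parameter tuples are pooled: the new domain consists of the concatenations `c ++ x` with `c`
in the orbit of `b` and `x ∈ D_c`. As every `c` has length `p`, the splitting is unique, so sending
`c ++ x` to `f_{c,b}([x])` is a well-defined partial map on finite tuples (`pooledMap`), onto `A_b ≅
A` because `f_{b,b} = id`. Pulling equality and the relations of `A_b` back along it gives an
interpretation of `A` (`interprets_of_partialMap`).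

It remains to define the pullbacks by `Σ₁` formulas without parameters. Given a formula `Θ` of the
old interpretation, say of `c_j ++ x_j` that there are some `c` in the orbit and `y_j` with `F(c_j,
c, x_j, y_j)` and `Θ_c(y_1, …, y_k)`. By coherence, `f_{c,b}[y_j] = f_{c_j,b}[x_j]` whichever `c` is
found, and `f_{c,b}` is an isomorphism, so the choice of `c` is immaterial; conversely `c = b`
always serves (`genHolds_transfer`). Complements need no negation, since they come with `Σ₁`
formulas that are transferred in the same way.

The rest is effectiveness: such formulas form a computable sequence because substitution and
conjunction act primitive recursively on codes, and because `Σ₁` formulas are closed under finite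
conjunction, existential quantification and c.e. disjunction (`SigmaOneSeq.query`, `realize_query`,
`realize_transfer`). -/

namespace EffInt

/-! ### Closure properties of c.e. predicates -/

section RecursivelyEnumerable

variable {α β : Type*} [Primcodable α] [Primcodable β]

theorem rePred_of_exists_primrecRel {r : α → β → Prop} (hr : PrimrecRel r) :
    REPred fun a => ∃ b, r a b := by
  classical
  have h1 : Primrec₂ fun (a : α) (n : ℕ) =>
      ((Encodable.decode n : Option β).map fun b => decide (r a b)).getD false :=
    Primrec.option_getD.comp
      (Primrec.option_map (Primrec.decode.comp Primrec.snd)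
        (PrimrecPred.decide (hr.comp (Primrec.fst.comp Primrec.fst) Primrec.snd)).to₂) (Primrec.const false)
  have h2 : Partrec fun a : α => Nat.rfind fun n =>
      (Part.some (((Encodable.decode n : Option β).map fun b => decide (r a b)).getD false) :
        Part Bool) :=
    Partrec.rfind (Computable₂.partrec₂ h1.to_comp)
  refine h2.dom_re.of_eq fun a => ?_
  refine Nat.rfind_dom.trans ⟨?_, ?_⟩
  · rintro ⟨n, hn, -⟩
    have hn := Part.mem_some_iff.1 hn
    cases hd : (Encodable.decode n : Option β) with
    | none => simp [hd] at hn
    | some b => exact ⟨b, by simpa [hd] using hn.symm⟩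
  · rintro ⟨b, hb⟩
    exact ⟨Encodable.encode b, Part.mem_some_iff.2 (by simpa using hb), fun _ => trivial⟩

/-- Normal form: the witness `n` bounds the computation of a program that halts exactly on `p`.
Closure properties then reduce to combining witnesses. -/
theorem exists_primrecRel_of_rePred {p : α → Prop} (hp : REPred p) :
    ∃ r : α → ℕ → Prop, PrimrecRel r ∧ ∀ a, p a ↔ ∃ n, r a n := by
  obtain ⟨c, hc⟩ := Nat.Partrec.Code.exists_code.1 hp
  refine ⟨fun a n => (Nat.Partrec.Code.evaln n c (Encodable.encode a)).isSome = true, ?_, ?_⟩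
  · refine ⟨fun _ => inferInstance, ?_⟩
    have := Primrec.option_isSome.comp (Nat.Partrec.Code.primrec_evaln.comp
      ((Primrec.snd (α := α) (β := ℕ)).pair (Primrec.const c) |>.pair
        (Primrec.encode.comp Primrec.fst)))
    exact this.of_eq fun a => by simp
  · intro a
    have h := congrFun hc (Encodable.encode a)
    have h2 : p a ↔ (Nat.Partrec.Code.eval c (Encodable.encode a)).Dom := by
      rw [h]
      simp [Part.assert]
    rw [h2, Part.dom_iff_mem]
    simp only [Nat.Partrec.Code.evaln_complete, Option.isSome_iff_exists, Option.mem_def]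
    exact exists_comm

theorem rePred_comp {p : β → Prop} (hp : REPred p) {f : α → β} (hf : Primrec f) :
    REPred fun a => p (f a) := by
  obtain ⟨r, hr, h⟩ := exists_primrecRel_of_rePred hp
  exact (rePred_of_exists_primrecRel (r := fun a n => r (f a) n)
    (hr.comp (hf.comp Primrec.fst) Primrec.snd)).of_eq
    fun a => (h (f a)).symm

theorem rePred_of_primrecPred {p : α → Prop} (hp : PrimrecPred p) : REPred p :=
  (rePred_of_exists_primrecRel (β := Unit) (r := fun a _ => p a) (hp.comp Primrec.fst)).of_eq
    fun _ => ⟨fun ⟨_, h⟩ => h, fun h => ⟨(), h⟩⟩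

theorem rePred_and {p q : α → Prop} (hp : REPred p) (hq : REPred q) :
    REPred fun a => p a ∧ q a := by
  obtain ⟨r, hr, h⟩ := exists_primrecRel_of_rePred hp
  obtain ⟨s, hs, h'⟩ := exists_primrecRel_of_rePred hq
  refine (rePred_of_exists_primrecRel (β := ℕ × ℕ) (r := fun a n => r a n.1 ∧ s a n.2)
    (PrimrecPred.and (hr.comp Primrec.fst (Primrec.fst.comp Primrec.snd))
      (hs.comp Primrec.fst (Primrec.snd.comp Primrec.snd)))).of_eq fun a => ?_
  rw [h, h']
  exact ⟨fun ⟨n, h1, h2⟩ => ⟨⟨_, h1⟩, ⟨_, h2⟩⟩, fun ⟨⟨_, h1⟩, ⟨_, h2⟩⟩ => ⟨(_, _), h1, h2⟩⟩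

theorem rePred_or {p q : α → Prop} (hp : REPred p) (hq : REPred q) :
    REPred fun a => p a ∨ q a := by
  obtain ⟨r, hr, h⟩ := exists_primrecRel_of_rePred hp
  obtain ⟨s, hs, h'⟩ := exists_primrecRel_of_rePred hq
  refine (rePred_of_exists_primrecRel (r := fun a n => r a n ∨ s a n)
    (PrimrecPred.or hr hs)).of_eq fun a => ?_
  rw [h, h', exists_or]

theorem rePred_exists {p : α × β → Prop} (hp : REPred p) : REPred fun a => ∃ b, p (a, b) := by
  obtain ⟨r, hr, h⟩ := exists_primrecRel_of_rePred hp
  refine (rePred_of_exists_primrecRel (β := β × ℕ) (r := fun a n => r (a, n.1) n.2)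
    (hr.comp (Primrec.fst.pair (Primrec.fst.comp Primrec.snd))
      (Primrec.snd.comp Primrec.snd))).of_eq fun a => ?_
  simp only [h, Prod.exists]

/-- A list pairing each element with a witness for it turns the bounded universal quantifier into a
single existential one. -/
theorem rePred_forall_mem {p : α → Prop} (hp : REPred p) :
    REPred fun l : List α => ∀ a ∈ l, p a := by
  obtain ⟨r, hr, h⟩ := exists_primrecRel_of_rePred hp
  have h1 : PrimrecPred fun l : List (α × ℕ) => ∀ x ∈ l, r x.1 x.2 :=
    PrimrecPred.forall_mem_list hr
  refine (rePred_of_exists_primrecRel (β := List (α × ℕ))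
    (r := fun l l' => l'.map Prod.fst = l ∧ ∀ x ∈ l', r x.1 x.2)
    (PrimrecPred.and (Primrec.eq.comp
      (Primrec.list_map Primrec.snd (Primrec.fst.comp Primrec.snd).to₂) Primrec.fst)
      (h1.comp Primrec.snd))).of_eq fun l => ?_
  constructor
  · rintro ⟨l', rfl, hl'⟩ a ha
    obtain ⟨x, hx, rfl⟩ := List.mem_map.1 ha
    exact (h _).2 ⟨_, hl' x hx⟩
  · intro hl
    induction l with
    | nil => exact ⟨[], by simp⟩
    | cons a l ih =>
      obtain ⟨l', hl', hr'⟩ := ih fun b hb => hl b (List.mem_cons_of_mem _ hb)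
      obtain ⟨n, hn⟩ := (h a).1 (hl a List.mem_cons_self)
      exact ⟨(a, n) :: l', by simp [hl'], by simpa using ⟨hn, fun a b => hr' (a, b)⟩⟩

end RecursivelyEnumerable

end EffInt
namespace EffInt

/-! ### Substitution of variables in formulas and in their codes -/

section Rename

variable {L : FirstOrder.Language.{u₁, v₁}} {α β : Type}

theorem listEncode_relabel (g : α → β) (t : L.Term α) :
    (t.relabel g).listEncode = t.listEncode.map (Sum.map g id) := by
  induction t with
  | var a => simp [Term.relabel, Term.listEncode]
  | func f ts ih =>
    simp only [Term.relabel, Term.listEncode, List.map_cons, Sum.map_inr, id, List.map_flatMap]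
    congr 1
    exact List.flatMap_congr fun i _ => ih i

/-- Substitution of variables for the free variables of a formula. -/
def rename (g : α → β) {n : ℕ} (φ : L.BoundedFormula α n) : L.BoundedFormula β n :=
  φ.mapTermRel (fun _ t => t.relabel (Sum.map g id)) (fun _ => id) (fun _ => id)

theorem isQF_rename (g : α → β) {n : ℕ} {φ : L.BoundedFormula α n} (h : φ.IsQF) :
    (rename g φ).IsQF := by
  induction h with
  | falsum => exact .falsum
  | of_isAtomic h =>
    cases h with
    | equal t₁ t₂ => exact .of_isAtomic (.equal _ _)
    | rel R ts => exact .of_isAtomic (.rel _ _)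
  | imp _ _ ih₁ ih₂ => exact .imp ih₁ ih₂

theorem realize_rename {B : Type w₂} [L.Structure B] (g : α → β) (φ : L.Formula α) (v : β → B) :
    Formula.Realize (rename g φ : L.Formula β) v ↔ φ.Realize (v ∘ g) := by
  refine BoundedFormula.realize_mapTermRel_id (fun n t xs => ?_) (fun _ _ _ => rfl)
  rw [Term.realize_relabel, Sum.elim_comp_map, Function.comp_id]

/-- The letters of codes of formulas. -/
abbrev Letter (L : FirstOrder.Language.{u₁, v₁}) : Type (max u₁ v₁) :=
  (ℕ × List (ℕ ⊕ (Σ i, L.Functions i))) ⊕ ((Σ n, L.Relations n) ⊕ ℕ)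

/-- The effect on letters of a substitution of variables. -/
def renameLetter (g : ℕ → ℕ) : Letter L → Letter L :=
  Sum.map (Prod.map id (List.map (Sum.map g id))) id

/-- Codes number bound variables from `N` on, so passing to `N'` would shift them. A quantifier-free
formula has none, and the substitution acts letter by letter. The extension `g'` of `g` to all of
`ℕ` lets it act on arbitrary words. -/
theorem formulaCode_rename {N N' : ℕ} (g : Fin N → Fin N') (g' : ℕ → ℕ)
    (hg : ∀ i, (g i : ℕ) = g' i) {φ : L.Formula (Fin N)} (h : BoundedFormula.IsQF φ) :
    formulaCode ⟨N', (rename g φ : L.Formula (Fin N'))⟩ =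
      (N', (formulaCode ⟨N, φ⟩).2.map (renameLetter g')) := by
  have ht : ∀ t : L.Term (Fin N ⊕ Fin 0), termCode N' ⟨0, t.relabel (Sum.map g id)⟩ =
      Prod.map id (List.map (Sum.map g' id)) (termCode N ⟨0, t⟩) := by
    intro t
    simp only [termCode, Prod.map_apply, id, Prod.mk.injEq, true_and, ← listEncode_relabel,
      Term.relabel_relabel]
    congr 1
    refine congrArg (fun k => Term.relabel k t) (funext fun x => ?_)
    rcases x with i | i
    · simp [hg]
    · exact i.elim0
  simp only [formulaCode, Prod.mk.injEq, true_and]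
  induction h with
  | falsum => simp [rename, BoundedFormula.mapTermRel, BoundedFormula.listEncode, renameLetter]
  | of_isAtomic h =>
    cases h with
    | equal t₁ t₂ =>
      simp [rename, BoundedFormula.mapTermRel, BoundedFormula.listEncode, renameLetter, ht,
        Term.bdEqual]
    | rel R ts =>
      simp [rename, BoundedFormula.mapTermRel, BoundedFormula.listEncode, renameLetter, ht,
        Relations.boundedFormula]
  | imp _ _ ih₁ ih₂ =>
    simp only [rename] at ih₁ ih₂
    simp [rename, BoundedFormula.mapTermRel, BoundedFormula.listEncode, renameLetter, ih₁, ih₂]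

end Rename

/-! ### Conjunctions of instances with separate witnesses -/

section Conjunction

variable {L : FirstOrder.Language.{u₁, v₁}}

/-- The variable substituted for the `i`-th variable of a formula, if `vs` is to be substituted for
its first variables, and variables numbered from `N` on for the others. -/
def instVar (vs : List ℕ) (N i : ℕ) : ℕ :=
  if vs.getD i N < N then vs.getD i N else N + i

/-- No condition on `vs` is needed: a missing entry gets the default `N`, and every entry `≥ N` is
replaced by the fresh variable `N + i`. -/
theorem instVar_lt (vs : List ℕ) (N : ℕ) {i N' : ℕ} (h : i < N') : instVar vs N i < N + N' := by
  unfold instVar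
  split_ifs <;> omega

/-- The conjunction of `θ'` and an instance of `θ`. -/
def conjStep (vs : List ℕ) (θ θ' : Σ N, L.Formula (Fin N)) : Σ N, L.Formula (Fin N) :=
  -- The witnesses of `θ` get a block of fresh variables after those of `θ'`. Its first `vs.length`
  -- places stay idle when the entries of `vs` are below `θ'.1`.
  ⟨θ'.1 + θ.1,
    (rename (fun i => ⟨instVar vs θ'.1 i, instVar_lt _ _ i.2⟩ : Fin θ.1 → Fin (θ'.1 + θ.1)) θ.2 :
      L.Formula (Fin (θ'.1 + θ.1))) ⊓ (rename (Fin.castAdd θ.1) θ'.2 : L.Formula _)⟩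

/-- The code of a conjunction. -/
def infCode (c c' : List (Letter L)) : List (Letter L) :=
  -- The letter `0` stands for implication and `2` for falsum without bound variables; the word
  -- spells `(φ → (ψ → ⊥)) → ⊥`.
  .inr (.inr 0) :: .inr (.inr 0) :: (c ++ .inr (.inr 0) :: (c' ++ [.inr (.inr 2)])) ++
    [.inr (.inr 2)]

/-- The operation on codes that corresponds to `conjStep`. -/
def conjStepCode (vs : List ℕ) (c c' : FormulaCode L) : FormulaCode L :=
  (c'.1 + c.1, infCode (c.2.map (renameLetter (instVar vs c'.1))) c'.2)

theorem formulaCode_inf {N : ℕ} (φ ψ : L.Formula (Fin N)) :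
    formulaCode ⟨N, φ ⊓ ψ⟩ = (N, infCode (formulaCode ⟨N, φ⟩).2 (formulaCode ⟨N, ψ⟩).2) := by
  change formulaCode ⟨N, ((BoundedFormula.imp φ (BoundedFormula.imp ψ .falsum)).imp .falsum)⟩ = _
  simp [formulaCode, infCode, BoundedFormula.listEncode]

theorem renameLetter_id : (renameLetter id : Letter L → Letter L) = id := by
  simp [renameLetter]

theorem formulaCode_conjStep (vs : List ℕ) {θ θ' : Σ N, L.Formula (Fin N)}
    (h : BoundedFormula.IsQF θ.2) (h' : BoundedFormula.IsQF θ'.2) :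
    formulaCode (conjStep vs θ θ') = conjStepCode vs (formulaCode θ) (formulaCode θ') := by
  rw [conjStep, formulaCode_inf, formulaCode_rename _ (instVar vs θ'.1) (fun _ => rfl) h,
    formulaCode_rename (Fin.castAdd θ.1) id (fun _ => rfl) h', renameLetter_id, List.map_id]
  rfl

theorem isQF_conjStep (vs : List ℕ) {θ θ' : Σ N, L.Formula (Fin N)}
    (h : BoundedFormula.IsQF θ.2) (h' : BoundedFormula.IsQF θ'.2) :
    BoundedFormula.IsQF (conjStep vs θ θ').2 :=
  (isQF_rename _ h).inf (isQF_rename _ h')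

/-- The conjunction of the instances `θ(vs, …)` for the pairs `(vs, θ)` in a list, in at least `M`
variables. -/
def conjFormula (M : ℕ) : List (List ℕ × Σ N, L.Formula (Fin N)) → Σ N, L.Formula (Fin N)
  | [] => ⟨M, (⊤ : L.Formula (Fin M))⟩
  | a :: l => conjStep a.1 a.2 (conjFormula M l)

/-- The operation on codes that corresponds to `conjFormula`. -/
def conjCode (M : ℕ) (l : List (List ℕ × FormulaCode L)) : FormulaCode L :=
  l.foldr (fun a c => conjStepCode a.1 a.2 c)
    (M, [.inr (.inr 0), .inr (.inr 2), .inr (.inr 2)])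

theorem isQF_conjFormula (M : ℕ) (l : List (List ℕ × Σ N, L.Formula (Fin N)))
    (h : ∀ a ∈ l, BoundedFormula.IsQF a.2.2) : BoundedFormula.IsQF (conjFormula M l).2 := by
  induction l with
  | nil => exact .top
  | cons a l ih =>
    exact isQF_conjStep _ (h a List.mem_cons_self) (ih fun b hb => h b (List.mem_cons_of_mem _ hb))

theorem le_conjFormula (M : ℕ) (l : List (List ℕ × Σ N, L.Formula (Fin N))) :
    M ≤ (conjFormula M l).1 := by
  induction l with
  | nil => exact le_rfl
  | cons a l ih => exact ih.trans (Nat.le_add_right _ _)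

theorem formulaCode_conjFormula (M : ℕ) (l : List (List ℕ × Σ N, L.Formula (Fin N)))
    (h : ∀ a ∈ l, BoundedFormula.IsQF a.2.2) :
    formulaCode (conjFormula M l) = conjCode M (l.map (Prod.map id formulaCode)) := by
  induction l with
  | nil =>
    change formulaCode ⟨M, BoundedFormula.imp .falsum .falsum⟩ = _
    simp [formulaCode, BoundedFormula.listEncode, conjCode]
  | cons a l ih =>
    have h' := fun b hb => h b (List.mem_cons_of_mem _ hb)
    rw [conjFormula, formulaCode_conjStep _ (h a List.mem_cons_self) (isQF_conjFormula M l h'),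
      ih h']
    rfl

/-- The values of the variables `vs` under the assignment `z`. -/
def vals {B : Type*} (z : List B) (vs : List ℕ) : List B :=
  vs.filterMap (z[·]?)

/-- `vals` silently drops variables out of range. When there are none it is an honest map, from
which its length and entries are read off. -/
theorem map_getElem?_of_lt {B : Type*} (z : List B) (vs : List ℕ) (h : ∀ v ∈ vs, v < z.length) :
    vs.map (z[·]?) = (vals z vs).map some := by
  induction vs with
  | nil => rfl
  | cons v vs ih =>
    have hv := h v List.mem_cons_self
    simp only [vals] at ih
    simp [vals, List.getElem?_eq_getElem hv, ih fun w hw => h w (List.mem_cons_of_mem _ hw)]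

theorem length_vals {B : Type*} {z : List B} {vs : List ℕ} (h : ∀ v ∈ vs, v < z.length) :
    (vals z vs).length = vs.length := by
  simpa using (congrArg List.length (map_getElem?_of_lt z vs h)).symm

theorem getElem?_vals {B : Type*} {z : List B} {vs : List ℕ} (h : ∀ v ∈ vs, v < z.length)
    {i : ℕ} (hi : i < vs.length) : (vals z vs)[i]? = z[vs[i] ]? := by
  have h1 := congrArg (·[i]?) (map_getElem?_of_lt z vs h)
  have h2 : i < (vals z vs).length := by rwa [length_vals h]
  simp only [List.getElem?_map, List.getElem?_eq_getElem hi, List.getElem?_eq_getElem h2,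
    Option.map_some, Option.some.injEq] at h1
  rw [h1, List.getElem?_eq_getElem h2]

theorem prefix_ofFn_iff {B : Type*} {z : List B} {N : ℕ} {w : Fin N → B} (hN : z.length ≤ N) :
    z <+: List.ofFn w ↔ ∀ (i : Fin N), (i : ℕ) < z.length → z[(i : ℕ)]? = some (w i) := by
  rw [List.prefix_iff_getElem?]
  constructor
  · intro h i hi
    have := h i hi
    rw [List.getElem?_eq_getElem hi, ← this]
    simp
  · intro h i hi
    have := h ⟨i, by omega⟩ hi
    rw [List.getElem?_eq_getElem hi] at this
    rw [this]
    simp [show i < N by omega]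

/-- Since each conjunct has its own block of fresh variables, witnesses for the conjuncts can be
chosen independently and glued together. -/
theorem realize_conjFormula {B : Type w₂} [L.Structure B] {M : ℕ} {z : List B} (hz : z.length = M)
    (l : List (List ℕ × Σ N, L.Formula (Fin N)))
    (hl : ∀ a ∈ l, a.1.length ≤ a.2.1 ∧ ∀ v ∈ a.1, v < M) :
    (∃ w : Fin (conjFormula M l).1 → B, z <+: List.ofFn w ∧ (conjFormula M l).2.Realize w) ↔
      ∀ a ∈ l, ∃ v : Fin a.2.1 → B, vals z a.1 <+: List.ofFn v ∧ a.2.2.Realize v := by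
  induction l with
  | nil =>
    simp only [List.not_mem_nil, IsEmpty.forall_iff, implies_true, iff_true]
    subst hz
    exact ⟨fun i => z[i], (prefix_ofFn_iff le_rfl).2 fun i hi => List.getElem?_eq_getElem hi, Formula.realize_top.2 trivial⟩
  | cons a l ih =>
    obtain ⟨vs, θ⟩ := a
    replace ih := ih fun a ha => hl a (List.mem_cons_of_mem _ ha)
    obtain ⟨h1, h2⟩ := hl _ List.mem_cons_self
    simp only at h1 h2
    rw [List.forall_mem_cons, ← ih]
    have hM := le_conjFormula M l
    have h2' : ∀ v ∈ vs, v < z.length := by rwa [hz]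
    have hlen := length_vals h2'
    set θ' := conjFormula M l with hθ'
    have hzθ : z.length ≤ θ'.1 := by omega
    have hvθ : (vals z vs).length ≤ θ.1 := by omega
    have key : ∀ w : Fin (θ'.1 + θ.1) → B, (conjStep vs θ θ').2.Realize w ↔
        θ.2.Realize (fun i : Fin θ.1 => w ⟨instVar vs θ'.1 i, instVar_lt _ _ i.2⟩) ∧
          θ'.2.Realize (fun i => w (Fin.castAdd θ.1 i)) := by
      intro w
      simp only [conjStep]
      rw [Formula.realize_inf, realize_rename, realize_rename]
      rfl
    have hinst : ∀ (i : ℕ) (hi : i < vs.length), instVar vs θ'.1 i = vs[i] := by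
      intro i hi
      have := h2 _ (List.getElem_mem hi)
      have h3 : vs[i] < θ'.1 := by omega
      simp [instVar, hi, h3]
    have hinst' : ∀ i : ℕ, vs.length ≤ i → instVar vs θ'.1 i = θ'.1 + i := by
      intro i hi
      simp [instVar, hi]
    change (∃ w : Fin (θ'.1 + θ.1) → B, z <+: List.ofFn w ∧ (conjStep vs θ θ').2.Realize w) ↔ _
    constructor
    · rintro ⟨w, hw, hr⟩
      rw [key] at hr
      rw [prefix_ofFn_iff (by omega)] at hw
      refine ⟨⟨_, ?_, hr.1⟩, ⟨_, ?_, hr.2⟩⟩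
      · rw [prefix_ofFn_iff hvθ]
        intro i hi
        rw [hlen] at hi
        rw [getElem?_vals h2' hi]
        have h4 := h2' _ (List.getElem_mem hi)
        simp only [hinst i hi]
        exact hw ⟨vs[(i : ℕ)], by omega⟩ h4
      · rw [prefix_ofFn_iff hzθ]
        intro i hi
        exact hw (Fin.castAdd θ.1 i) hi
    · rintro ⟨⟨v, hv, hr⟩, ⟨w, hw, hr'⟩⟩
      rw [prefix_ofFn_iff hvθ] at hv
      rw [prefix_ofFn_iff hzθ] at hw
      -- `w` serves the earlier conjuncts and `v` the new one; the values of `v` on `vs` already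
      -- occur in `w`.
      refine ⟨Fin.append w v, ?_, (key _).2 ⟨?_, ?_⟩⟩
      · rw [prefix_ofFn_iff (by omega)]
        intro i hi
        have h5 : i = Fin.castAdd θ.1 ⟨i, by omega⟩ := rfl
        rw [h5, Fin.append_left]
        exact hw ⟨i, by omega⟩ hi
      · convert hr using 2 with i
        by_cases hi : (i : ℕ) < vs.length
        · have h4 := h2' _ (List.getElem_mem hi)
          have h6 := hv i (by rwa [hlen])
          rw [getElem?_vals h2' hi, hw ⟨vs[(i : ℕ)], by omega⟩ h4] at h6
          simp only [hinst i hi]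
          rw [← Option.some.inj h6, ← Fin.append_left w v]
          rfl
        · simp only [hinst' i (by omega)]
          exact Fin.append_right w v i
      · simpa only [Fin.append_left] using hr'

end Conjunction

end EffInt
namespace EffInt

/-! ### The operations on codes are primitive recursive -/

section PrimrecCodes

variable {L : FirstOrder.Language.{u₁, v₁}} [ComputableLanguage L]

theorem primrec_instVar : Primrec fun x : (List ℕ × ℕ) × ℕ => instVar x.1.1 x.1.2 x.2 := by
  have h : Primrec fun x : (List ℕ × ℕ) × ℕ => x.1.1.getD x.2 x.1.2 :=
    (Primrec.option_getD.comp
      (Primrec.list_getElem?.comp (Primrec.fst.comp Primrec.fst) Primrec.snd)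
      (Primrec.snd.comp Primrec.fst)).of_eq fun x => by rw [List.getD_eq_getElem?_getD]
  exact Primrec.ite (Primrec.nat_lt.comp h (Primrec.snd.comp Primrec.fst)) h
    (Primrec.nat_add.comp (Primrec.snd.comp Primrec.fst) Primrec.snd)

theorem primrec_renameLetter : Primrec fun x : (List ℕ × ℕ) × Letter L =>
    renameLetter (instVar x.1.1 x.1.2) x.2 := by
  have h1 : Primrec fun x : (List ℕ × ℕ) × (ℕ ⊕ (Σ i, L.Functions i)) =>
      Sum.map (instVar x.1.1 x.1.2) id x.2 :=
    (Primrec.sumCasesOn Primrec.snd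
      (Primrec.sumInl.comp (primrec_instVar.comp
        ((Primrec.fst.comp Primrec.fst).pair Primrec.snd))).to₂
      (Primrec.sumInr.comp Primrec.snd).to₂).of_eq fun x => by rcases x with ⟨_, _ | _⟩ <;> rfl
  have h2 : Primrec fun x : (List ℕ × ℕ) × List (ℕ ⊕ (Σ i, L.Functions i)) =>
      x.2.map (Sum.map (instVar x.1.1 x.1.2) id) :=
    Primrec.list_map Primrec.snd
      (h1.comp ((Primrec.fst.comp Primrec.fst).pair Primrec.snd)).to₂
  exact (Primrec.sumCasesOn Primrec.snd
      (Primrec.sumInl.comp ((Primrec.fst.comp Primrec.snd).pair (h2.comp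
        ((Primrec.fst.comp Primrec.fst).pair (Primrec.snd.comp Primrec.snd))))).to₂
      (Primrec.sumInr.comp Primrec.snd).to₂).of_eq fun x => by rcases x with ⟨_, _ | _⟩ <;> rfl

theorem primrec_infCode : Primrec₂ (infCode (L := L)) := by
  unfold infCode
  exact Primrec.list_append.comp
    (Primrec.list_cons.comp (Primrec.const _) (Primrec.list_cons.comp (Primrec.const _)
      (Primrec.list_append.comp Primrec.fst (Primrec.list_cons.comp (Primrec.const _)
        (Primrec.list_append.comp Primrec.snd (Primrec.const _)))))) (Primrec.const _)

theorem primrec_conjStepCode : Primrec fun x : (List ℕ × FormulaCode L) × FormulaCode L =>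
    conjStepCode x.1.1 x.1.2 x.2 := by
  have hc : Primrec fun x : (List ℕ × FormulaCode L) × FormulaCode L => x.1.2 :=
    Primrec.snd.comp Primrec.fst
  have hN : Primrec fun x : (List ℕ × FormulaCode L) × FormulaCode L => x.2.1 :=
    Primrec.fst.comp Primrec.snd
  refine Primrec.pair (Primrec.nat_add.comp hN (Primrec.fst.comp hc))
    (primrec_infCode.comp (Primrec.list_map (Primrec.snd.comp hc) ?_)
      (Primrec.snd.comp Primrec.snd))
  exact (primrec_renameLetter.comp ((((Primrec.fst.comp Primrec.fst).pair hN).comp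
    Primrec.fst).pair Primrec.snd)).to₂

theorem primrec_conjCode : Primrec₂ (conjCode (L := L)) :=
  Primrec.list_foldr Primrec.snd (Primrec.fst.pair (Primrec.const _))
    (primrec_conjStepCode.comp Primrec.snd).to₂

end PrimrecCodes

/-! ### Closure of computable sequences of `Σ₁` formulas -/

namespace SigmaOneSeq

variable {L : FirstOrder.Language.{u₁, v₁}} [ComputableLanguage L]

/-- The sequence that consists of the formulas of two given sequences. -/
def sum {ι : Type w₁} {κ : Type w₂} [Primcodable ι] [Primcodable κ] {ar : ι → ℕ} {ar' : κ → ℕ}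
    (Φ : SigmaOneSeq L ι ar) (Ψ : SigmaOneSeq L κ ar') :
    SigmaOneSeq L (ι ⊕ κ) (Sum.elim ar ar') where
  disj := Sum.elim Φ.disj Ψ.disj
  ar_le := by
    rintro (i | i)
    · exact Φ.ar_le i
    · exact Ψ.ar_le i
  isQF := by
    rintro (i | i)
    · exact Φ.isQF i
    · exact Ψ.isQF i
  ce := by
    have h1 : REPred fun z : (ι ⊕ κ) × FormulaCode L => ∃ i, z.1 = Sum.inl i ∧
        ∃ θ ∈ Φ.disj i, formulaCode θ = z.2 :=
      rePred_exists (p := fun z : ((ι ⊕ κ) × FormulaCode L) × ι => z.1.1 = Sum.inl z.2 ∧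
          ∃ θ ∈ Φ.disj z.2, formulaCode θ = z.1.2) <| rePred_and
        (rePred_of_primrecPred (Primrec.eq.comp (Primrec.fst.comp Primrec.fst)
          (Primrec.sumInl.comp Primrec.snd)))
        (rePred_comp Φ.ce (Primrec.snd.pair (Primrec.snd.comp Primrec.fst)))
    have h2 : REPred fun z : (ι ⊕ κ) × FormulaCode L => ∃ i, z.1 = Sum.inr i ∧
        ∃ θ ∈ Ψ.disj i, formulaCode θ = z.2 :=
      rePred_exists (p := fun z : ((ι ⊕ κ) × FormulaCode L) × κ => z.1.1 = Sum.inr z.2 ∧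
          ∃ θ ∈ Ψ.disj z.2, formulaCode θ = z.1.2) <| rePred_and
        (rePred_of_primrecPred (Primrec.eq.comp (Primrec.fst.comp Primrec.fst)
          (Primrec.sumInr.comp Primrec.snd)))
        (rePred_comp Ψ.ce (Primrec.snd.pair (Primrec.snd.comp Primrec.fst)))
    refine (rePred_or h1 h2).of_eq ?_
    rintro ⟨i | i, c⟩ <;> simp

variable {ι : Type w₁} [Primcodable ι] {ar : ι → ℕ}

/-- The sequence of the formulas which say that, for some `(M, l)` with `S j M l`, the given tuple
can be extended to an `M`-tuple that satisfies, for every `(i, vs)` in the list `l`, the formula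
`Ψ_i(vs)`. -/
def query {κ : Type*} [Primcodable κ] (Ψ : SigmaOneSeq L ι ar) (ar' : κ → ℕ)
    (S : κ → ℕ → List (ι × List ℕ) → Prop)
    (hS : REPred fun x : κ × ℕ × List (ι × List ℕ) => S x.1 x.2.1 x.2.2)
    (hle : ∀ j M l, S j M l → ar' j ≤ M) : SigmaOneSeq L κ ar' where
  disj j := {θ | ∃ (M : ℕ) (l : List ((ι × List ℕ) × Σ N, L.Formula (Fin N))),
    S j M (l.map Prod.fst) ∧ (∀ a ∈ l, a.2 ∈ Ψ.disj a.1.1) ∧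
      θ = conjFormula M (l.map fun a => (a.1.2, a.2))}
  ar_le := by
    rintro j _ ⟨M, l, h, -, rfl⟩
    exact (hle _ _ _ h).trans (le_conjFormula M _)
  isQF := by
    rintro j _ ⟨M, l, -, h, rfl⟩
    refine isQF_conjFormula M _ fun a ha => ?_
    obtain ⟨b, hb, rfl⟩ := List.mem_map.1 ha
    exact Ψ.isQF _ _ (h b hb)
  ce := by
    have h1 : REPred fun l : List ((ι × List ℕ) × FormulaCode L) =>
        ∀ a ∈ l, ∃ θ ∈ Ψ.disj a.1.1, formulaCode θ = a.2 :=
      rePred_forall_mem (p := fun a : (ι × List ℕ) × FormulaCode L =>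
          ∃ θ ∈ Ψ.disj a.1.1, formulaCode θ = a.2)
        (rePred_comp Ψ.ce ((Primrec.fst.comp Primrec.fst).pair Primrec.snd))
    -- Enumeration works with codes only: guess `M` and a list of codes of disjuncts, and compute
    -- the code of the conjunction.
    have h2 : REPred fun z : κ × FormulaCode L =>
        ∃ x : ℕ × List ((ι × List ℕ) × FormulaCode L), S z.1 x.1 (x.2.map Prod.fst) ∧
          (∀ a ∈ x.2, ∃ θ ∈ Ψ.disj a.1.1, formulaCode θ = a.2) ∧
            conjCode x.1 (x.2.map fun a => (a.1.2, a.2)) = z.2 := by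
      refine rePred_exists (p := fun y : (κ × FormulaCode L) ×
        ℕ × List ((ι × List ℕ) × FormulaCode L) => S y.1.1 y.2.1 (y.2.2.map Prod.fst) ∧
          (∀ a ∈ y.2.2, ∃ θ ∈ Ψ.disj a.1.1, formulaCode θ = a.2) ∧
            conjCode y.2.1 (y.2.2.map fun a => (a.1.2, a.2)) = y.1.2) ?_
      have hl : Primrec fun y : (κ × FormulaCode L) × ℕ × List ((ι × List ℕ) × FormulaCode L) =>
          y.2.2 := Primrec.snd.comp Primrec.snd
      have hM : Primrec fun y : (κ × FormulaCode L) × ℕ × List ((ι × List ℕ) × FormulaCode L) =>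
          y.2.1 := Primrec.fst.comp Primrec.snd
      refine rePred_and (rePred_comp hS ((Primrec.fst.comp Primrec.fst).pair (hM.pair
        (Primrec.list_map hl (Primrec.fst.comp Primrec.snd).to₂)))) (rePred_and
          (rePred_comp h1 hl) (rePred_of_primrecPred (Primrec.eq.comp (primrec_conjCode.comp hM
            (Primrec.list_map hl ?_)) (Primrec.snd.comp Primrec.fst))))
      exact ((Primrec.snd.comp (Primrec.fst.comp Primrec.snd)).pair
        (Primrec.snd.comp Primrec.snd)).to₂
    refine h2.of_eq ?_
    -- Back from codes to formulas: each guessed code is the code of an actual disjunct.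
    have hlift : ∀ l : List ((ι × List ℕ) × FormulaCode L),
        (∀ a ∈ l, ∃ θ ∈ Ψ.disj a.1.1, formulaCode θ = a.2) →
        ∃ l' : List ((ι × List ℕ) × Σ N, L.Formula (Fin N)),
          (∀ a ∈ l', a.2 ∈ Ψ.disj a.1.1) ∧ l'.map (Prod.map id formulaCode) = l := by
      intro l hl
      induction l with
      | nil => exact ⟨[], by simp⟩
      | cons a l ih =>
        obtain ⟨l', h, rfl⟩ := ih fun b hb => hl b (List.mem_cons_of_mem _ hb)
        obtain ⟨θ, hθ, hc⟩ := hl a List.mem_cons_self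
        exact ⟨(a.1, θ) :: l', List.forall_mem_cons.2 ⟨hθ, h⟩, by simp [hc]⟩
    have hcode : ∀ (M : ℕ) (l : List ((ι × List ℕ) × Σ N, L.Formula (Fin N))),
        (∀ a ∈ l, a.2 ∈ Ψ.disj a.1.1) →
        formulaCode (conjFormula M (l.map fun a => (a.1.2, a.2))) =
          conjCode M ((l.map (Prod.map id formulaCode)).map fun a => (a.1.2, a.2)) := by
      intro M l hl
      rw [formulaCode_conjFormula, List.map_map, List.map_map]
      · rfl
      · intro a ha
        obtain ⟨b, hb, rfl⟩ := List.mem_map.1 ha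
        exact Ψ.isQF _ _ (hl b hb)
    rintro ⟨j, c⟩
    constructor
    · rintro ⟨⟨M, l⟩, hs, hl, hc⟩
      obtain ⟨l', h, rfl⟩ := hlift l hl
      refine ⟨_, ⟨M, l', ?_, h, rfl⟩, (hcode M l' h).trans hc⟩
      simpa [Function.comp_def] using hs
    · rintro ⟨_, ⟨M, l, hs, h, rfl⟩, hc⟩
      refine ⟨(M, l.map (Prod.map id formulaCode)), ?_, ?_, (hcode M l h).symm.trans hc⟩
      · simpa [Function.comp_def] using hs
      · intro a ha
        obtain ⟨b, hb, rfl⟩ := List.mem_map.1 ha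
        exact ⟨_, h b hb, rfl⟩

/-- The assumption `hwf` makes each `vs` fit the arity of its formula and stay below `M`, so that
`vals` truncates nothing. -/
theorem realize_query {κ : Type*} [Primcodable κ] {Ψ : SigmaOneSeq L ι ar} {ar' : κ → ℕ}
    {S : κ → ℕ → List (ι × List ℕ) → Prop}
    {hS : REPred fun x : κ × ℕ × List (ι × List ℕ) => S x.1 x.2.1 x.2.2}
    {hle : ∀ j M l, S j M l → ar' j ≤ M}
    (hwf : ∀ j M l, S j M l → ∀ a ∈ l, a.2.length = ar a.1 ∧ ∀ v ∈ a.2, v < M)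
    {B : Type*} [L.Structure B] (j : κ) (x : List B) :
    (Ψ.query ar' S hS hle).Realize j x ↔ x.length = ar' j ∧ ∃ M l, S j M l ∧
      ∃ z : List B, z.length = M ∧ x <+: z ∧ ∀ a ∈ l, Ψ.Realize a.1 (vals z a.2) := by
  refine and_congr_right fun hx => ⟨?_, ?_⟩
  · rintro ⟨_, ⟨M, l, hs, hl, rfl⟩, v, hv, hr⟩
    have hM := le_conjFormula M (l.map fun a => (a.1.2, a.2))
    -- The first `M` values form `z`; the others are the witnesses of the individual disjuncts.
    have hz : ((List.ofFn v).take M).length = M := by simpa using hM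
    refine ⟨M, _, hs, (List.ofFn v).take M, hz, ?_, ?_⟩
    · rw [List.prefix_take_iff]
      exact ⟨hv, hx.le.trans (hle _ _ _ hs)⟩
    · have h := (realize_conjFormula hz (l.map fun a => (a.1.2, a.2)) ?_).1
        ⟨v, List.take_prefix _ _, hr⟩
      · intro a ha
        obtain ⟨b, hb, rfl⟩ := List.mem_map.1 ha
        obtain ⟨w, hw, hr'⟩ := h _ (List.mem_map.2 ⟨b, hb, rfl⟩)
        have hb' := hwf _ _ _ hs _ ha
        exact ⟨by rw [length_vals (by rw [hz]; exact hb'.2), hb'.1], _, hl b hb, w, hw, hr'⟩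
      · intro a ha
        obtain ⟨b, hb, rfl⟩ := List.mem_map.1 ha
        have hb' := hwf _ _ _ hs _ (List.mem_map.2 ⟨b, hb, rfl⟩)
        exact ⟨hb'.1.trans_le (Ψ.ar_le _ _ (hl b hb)), hb'.2⟩
  · rintro ⟨M, l, hs, z, hz, hxz, hr⟩
    have hlift : ∀ l : List (ι × List ℕ), (∀ a ∈ l, Ψ.Realize a.1 (vals z a.2)) →
        ∃ l' : List ((ι × List ℕ) × Σ N, L.Formula (Fin N)), l'.map Prod.fst = l ∧
          ∀ a ∈ l', a.2 ∈ Ψ.disj a.1.1 ∧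
            ∃ v : Fin a.2.1 → B, vals z a.1.2 <+: List.ofFn v ∧ a.2.2.Realize v := by
      intro l hl
      induction l with
      | nil => exact ⟨[], by simp⟩
      | cons a l ih =>
        obtain ⟨l', rfl, h⟩ := ih fun b hb => hl b (List.mem_cons_of_mem _ hb)
        obtain ⟨-, θ, hθ, hv⟩ := hl a List.mem_cons_self
        exact ⟨(a, θ) :: l', rfl, List.forall_mem_cons.2 ⟨⟨hθ, hv⟩, h⟩⟩
    obtain ⟨l', rfl, h⟩ := hlift l hr
    obtain ⟨w, hw, hr'⟩ := (realize_conjFormula hz (l'.map fun a => (a.1.2, a.2)) (by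
      intro a ha
      obtain ⟨b, hb, rfl⟩ := List.mem_map.1 ha
      have hb' := hwf _ _ _ hs _ (List.mem_map.2 ⟨b, hb, rfl⟩)
      exact ⟨hb'.1.trans_le (Ψ.ar_le _ _ (h b hb).1), hb'.2⟩)).2 (by
      intro a ha
      obtain ⟨b, hb, rfl⟩ := List.mem_map.1 ha
      exact (h b hb).2)
    exact ⟨_, ⟨M, l', hs, fun a ha => (h a ha).1, rfl⟩, w, hxz.trans hw, hr'⟩

end SigmaOneSeq

end EffInt
namespace EffInt

/-! ### Naming blocks of a tuple by lists of variables -/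

section Values

variable {B : Type*}

theorem vals_append (z : List B) (vs ws : List ℕ) : vals z (vs ++ ws) = vals z vs ++ vals z ws :=
  List.filterMap_append

theorem vals_flatMap {α : Type*} (z : List B) (l : List α) (f : α → List ℕ) :
    vals z (l.flatMap f) = l.flatMap fun a => vals z (f a) := by
  induction l with
  | nil => rfl
  | cons a l ih => simp only [List.flatMap_cons, vals_append, ih]

theorem vals_range' {z pre x : List B} (h : pre ++ x <+: z) :
    vals z (List.range' pre.length x.length) = x := by
  obtain ⟨y, rfl⟩ := h
  apply List.map_injective_iff.2 (Option.some_injective B)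
  rw [← map_getElem?_of_lt]
  · apply List.ext_getElem
    · simp
    · intro i h1 h2
      have hi : i < x.length := by simpa using h2
      simp [List.getElem?_append, hi]
  · intro v hv
    simp only [List.mem_range'_1, List.length_append] at hv ⊢
    omega

theorem exists_vals_eq {z y : List B} (h : ∀ a ∈ y, a ∈ z) :
    ∃ vs, vals z vs = y ∧ ∀ v ∈ vs, v < z.length := by
  induction y with
  | nil => exact ⟨[], rfl, by simp⟩
  | cons a y ih =>
    obtain ⟨vs, rfl, hvs⟩ := ih fun b hb => h b (List.mem_cons_of_mem _ hb)
    obtain ⟨v, hv, rfl⟩ := List.mem_iff_getElem.1 (h a List.mem_cons_self)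
    exact ⟨v :: vs, by simp [vals, hv], List.forall_mem_cons.2 ⟨hv, hvs⟩⟩

/-- Values of triples of lists of variables. -/
def vals₃ (z : List B) (t : List ℕ × List ℕ × List ℕ) : List B × List B × List B :=
  (vals z t.1, vals z t.2.1, vals z t.2.2)

/-- The first two components of the triples are the consecutive blocks of `z` after `pre`, so their
variables are forced to be consecutive; the third may be named by any positions where their entries
occur. The prefix `pre` is there for the induction. -/
theorem exists_vals₃_eq {z pre : List B} (l : List (List B × List B × List B))
    (h : pre ++ l.flatMap (fun t => t.1 ++ t.2.1) <+: z) (h' : ∀ t ∈ l, ∀ a ∈ t.2.2, a ∈ z) :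
    ∃ vl : List (List ℕ × List ℕ × List ℕ), vl.map (vals₃ z) = l ∧
      (∀ t ∈ vl, ∀ v ∈ t.1 ++ t.2.1 ++ t.2.2, v < z.length) ∧
      vl.flatMap (fun t => t.1 ++ t.2.1) =
        List.range' pre.length (l.flatMap (fun t => t.1 ++ t.2.1)).length := by
  induction l generalizing pre with
  | nil => exact ⟨[], by simp⟩
  | cons t l ih =>
    obtain ⟨c, x, y⟩ := t
    simp only [List.flatMap_cons] at h
    obtain ⟨vl, rfl, hlt, hvl⟩ := ih (pre := pre ++ (c ++ x)) (by simpa using h)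
      fun t ht => h' t (List.mem_cons_of_mem _ ht)
    obtain ⟨vy, rfl, hy⟩ := exists_vals_eq (h' _ List.mem_cons_self)
    have hc : pre ++ c <+: z := .trans (by simp) h
    have hx : pre ++ c ++ x <+: z := .trans (by simp) h
    have hc' := hc.length_le
    have hx' := hx.length_le
    simp only [List.length_append] at hc' hx'
    refine ⟨(List.range' pre.length c.length, List.range' (pre ++ c).length x.length, vy) :: vl,
      ?_, List.forall_mem_cons.2 ⟨?_, hlt⟩, ?_⟩
    · simp only [List.map_cons, vals₃, vals_range' hc, vals_range' hx]
    · intro v hv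
      simp only [List.mem_append, List.mem_range'_1, List.length_append] at hv
      rcases hv with (hv | hv) | hv
      · omega
      · omega
      · exact hy v hv
    · simp only [List.flatMap_cons, hvl, List.length_append]
      rw [List.range'_append_1, ← Nat.add_assoc, Nat.add_assoc pre.length, ← Nat.add_assoc,
        ← List.range'_append_1 (m := c.length + x.length)]
      simp [Nat.add_assoc]

end Values

/-! ### The formulas that move all tuples to a common parameter -/

section Transfer

/-- The indices of the formulas that occur in `transfer`. -/
abbrev TransferIndex (ι : Type w₁) : Type w₁ :=
  Unit ⊕ (Unit × List ℕ) ⊕ (Unit × List ℕ) ⊕ (ι × List ℕ)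

/-- The conjuncts of the formula `transfer`, for variables `c` and triples `(c', x, y)` of lists of
variables. -/
def transferAtoms {ι : Type w₁} (p : ℕ) (i : ι) (c : List ℕ)
    (l : List (List ℕ × List ℕ × List ℕ)) : List (TransferIndex ι × List ℕ) :=
  -- The injections select, in this order, `φ`, `dom`, `F` and `Θ`, as in the sum of sequences used
  -- in `transfer`.
  (.inl (), c) ::
    (.inr (.inr (.inr (i, l.map fun t => t.2.2.length))), c ++ l.flatMap fun t => t.2.2) ::
    l.flatMap fun t => [(.inl (), t.1), (.inr (.inl ((), [t.2.1.length])), t.1 ++ t.2.1),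
      (.inr (.inr (.inl ((), [p, p, t.2.1.length, t.2.2.length]))), t.1 ++ c ++ t.2.1 ++ t.2.2)]

/-- The disjuncts of the formula `transfer`, in the format required by `SigmaOneSeq.query`. -/
def TransferRel {ι : Type w₁} (p : ℕ) (j : ι × List ℕ) (M : ℕ)
    (atoms : List (TransferIndex ι × List ℕ)) : Prop :=
  ∃ cl : List ℕ × List (List ℕ × List ℕ × List ℕ), cl.1.length = p ∧
    (∀ t ∈ cl.2, t.1.length = p) ∧ (cl.2.map fun t => (t.1 ++ t.2.1).length) = j.2 ∧
    -- The blocks `c_j ++ x_j` are precisely the free variables in their order. The variables for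
    -- `c` and the `y_j` are only required to be below `M`; beyond the free ones they are
    -- existentially quantified.
    (cl.2.flatMap fun t => t.1 ++ t.2.1) =
      List.range (cl.2.flatMap fun t => t.1 ++ t.2.1).length ∧
    (cl.2.flatMap fun t => t.1 ++ t.2.1).length ≤ M ∧
    (∀ a ∈ atoms, ∀ v ∈ a.2, v < M) ∧ atoms = transferAtoms p j.1 cl.1 cl.2

theorem primrec_transferAtoms {ι : Type w₁} [Primcodable ι] (p : ℕ) :
    Primrec fun x : ι × List ℕ × List (List ℕ × List ℕ × List ℕ) =>
      transferAtoms p x.1 x.2.1 x.2.2 := by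
  have hc : Primrec fun x : ι × List ℕ × List (List ℕ × List ℕ × List ℕ) => x.2.1 :=
    Primrec.fst.comp Primrec.snd
  have hl : Primrec fun x : ι × List ℕ × List (List ℕ × List ℕ × List ℕ) => x.2.2 :=
    Primrec.snd.comp Primrec.snd
  have hy : Primrec fun x : List ℕ × List ℕ × List ℕ => x.2.2 := Primrec.snd.comp Primrec.snd
  have hx : Primrec fun x : List ℕ × List ℕ × List ℕ => x.2.1 := Primrec.fst.comp Primrec.snd
  have hd : Primrec fun x : List ℕ × List ℕ × List ℕ => x.1 := Primrec.fst
  refine Primrec.list_cons.comp ((Primrec.const _).pair hc) (Primrec.list_cons.comp (Primrec.pair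
    (Primrec.sumInr.comp (Primrec.sumInr.comp (Primrec.sumInr.comp (Primrec.pair Primrec.fst
      (Primrec.list_map hl (Primrec.list_length.comp (hy.comp Primrec.snd)).to₂)))))
    (Primrec.list_append.comp hc (Primrec.list_flatMap hl (hy.comp Primrec.snd).to₂)))
    (Primrec.list_flatMap hl ?_))
  unfold Primrec₂
  refine Primrec.list_cons.comp ((Primrec.const _).pair (hd.comp Primrec.snd))
    (Primrec.list_cons.comp (Primrec.pair ?_ ?_) (Primrec.list_cons.comp (Primrec.pair ?_ ?_)
      (Primrec.const [])))
  · exact Primrec.sumInr.comp (Primrec.sumInl.comp ((Primrec.const ()).pair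
      (Primrec.list_cons.comp (Primrec.list_length.comp (hx.comp Primrec.snd)) (Primrec.const []))))
  · exact Primrec.list_append.comp (hd.comp Primrec.snd) (hx.comp Primrec.snd)
  · exact Primrec.sumInr.comp (Primrec.sumInr.comp (Primrec.sumInl.comp ((Primrec.const ()).pair
      (Primrec.list_cons.comp (Primrec.const p) (Primrec.list_cons.comp (Primrec.const p)
        (Primrec.list_cons.comp (Primrec.list_length.comp (hx.comp Primrec.snd))
          (Primrec.list_cons.comp (Primrec.list_length.comp (hy.comp Primrec.snd))
            (Primrec.const []))))))))
  · exact Primrec.list_append.comp (Primrec.list_append.comp (Primrec.list_append.comp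
      (hd.comp Primrec.snd) (hc.comp Primrec.fst)) (hx.comp Primrec.snd)) (hy.comp Primrec.snd)

/-- Only the lists of variables have to be guessed; all conditions on them are primitive recursive.
-/
theorem rePred_transferRel (ι : Type w₁) [Primcodable ι] (p : ℕ) :
    REPred fun x : (ι × List ℕ) × ℕ × List (TransferIndex ι × List ℕ) =>
      TransferRel p x.1 x.2.1 x.2.2 := by
  have h1 : PrimrecPred fun l : List (List ℕ × List ℕ × List ℕ) => ∀ t ∈ l, t.1.length = p :=
    PrimrecPred.forall_mem_list
      (Primrec.eq.comp (Primrec.list_length.comp Primrec.fst) (Primrec.const p))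
  have happ : Primrec fun t : List ℕ × List ℕ × List ℕ => t.1 ++ t.2.1 :=
    Primrec.list_append.comp Primrec.fst (Primrec.fst.comp Primrec.snd)
  have h2 : Primrec fun l : List (List ℕ × List ℕ × List ℕ) =>
      l.map fun t => (t.1 ++ t.2.1).length :=
    Primrec.list_map Primrec.id (Primrec.list_length.comp (happ.comp Primrec.snd)).to₂
  have h3 : Primrec fun l : List (List ℕ × List ℕ × List ℕ) => l.flatMap fun t => t.1 ++ t.2.1 :=
    Primrec.list_flatMap Primrec.id (happ.comp Primrec.snd).to₂
  have h4 : PrimrecRel fun (l : List (TransferIndex ι × List ℕ)) (M : ℕ) =>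
      ∀ a ∈ l, ∀ v ∈ a.2, v < M :=
    PrimrecRel.forall_mem_list (R := fun (a : TransferIndex ι × List ℕ) M => ∀ v ∈ a.2, v < M)
      ((PrimrecRel.forall_mem_list Primrec.nat_lt).comp (Primrec.snd.comp Primrec.fst) Primrec.snd)
  unfold TransferRel
  refine rePred_of_exists_primrecRel (r := fun
    (x : (ι × List ℕ) × ℕ × List (TransferIndex ι × List ℕ))
    (cl : List ℕ × List (List ℕ × List ℕ × List ℕ)) => cl.1.length = p ∧
    (∀ t ∈ cl.2, t.1.length = p) ∧ (cl.2.map fun t => (t.1 ++ t.2.1).length) = x.1.2 ∧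
    (cl.2.flatMap fun t => t.1 ++ t.2.1) =
      List.range (cl.2.flatMap fun t => t.1 ++ t.2.1).length ∧
    (cl.2.flatMap fun t => t.1 ++ t.2.1).length ≤ x.2.1 ∧
    (∀ a ∈ x.2.2, ∀ v ∈ a.2, v < x.2.1) ∧ x.2.2 = transferAtoms p x.1.1 cl.1 cl.2) ?_
  have hl : Primrec fun x : ((ι × List ℕ) × ℕ × List (TransferIndex ι × List ℕ)) ×
    (List ℕ × List (List ℕ × List ℕ × List ℕ)) => x.2.2 := Primrec.snd.comp Primrec.snd
  have hM : Primrec fun x : ((ι × List ℕ) × ℕ × List (TransferIndex ι × List ℕ)) ×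
    (List ℕ × List (List ℕ × List ℕ × List ℕ)) => x.1.2.1 :=
      Primrec.fst.comp (Primrec.snd.comp Primrec.fst)
  have ha : Primrec fun x : ((ι × List ℕ) × ℕ × List (TransferIndex ι × List ℕ)) ×
    (List ℕ × List (List ℕ × List ℕ × List ℕ)) => x.1.2.2 :=
      Primrec.snd.comp (Primrec.snd.comp Primrec.fst)
  refine PrimrecPred.and (Primrec.eq.comp (Primrec.list_length.comp
    (Primrec.fst.comp Primrec.snd)) (Primrec.const p)) ?_
  refine PrimrecPred.and (h1.comp hl) (PrimrecPred.and (Primrec.eq.comp (h2.comp hl)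
    (Primrec.snd.comp (Primrec.fst.comp Primrec.fst))) ?_)
  refine PrimrecPred.and (Primrec.eq.comp (h3.comp hl) (Primrec.list_range.comp
    (Primrec.list_length.comp (h3.comp hl)))) ?_
  refine PrimrecPred.and (Primrec.nat_le.comp (Primrec.list_length.comp (h3.comp hl)) hM) ?_
  exact PrimrecPred.and (h4.comp ha hM) (Primrec.eq.comp ha ((primrec_transferAtoms p).comp
    ((Primrec.fst.comp (Primrec.fst.comp Primrec.fst)).pair Primrec.snd)))

theorem TransferRel.sum_le {ι : Type w₁} {p : ℕ} {j : ι × List ℕ} {M : ℕ}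
    {atoms : List (TransferIndex ι × List ℕ)} (h : TransferRel p j M atoms) : 0 + j.2.sum ≤ M := by
  obtain ⟨cl, -, -, h1, -, h2, -⟩ := h
  rw [← h1, Nat.zero_add, ← List.length_flatMap]
  exact h2

theorem TransferRel.length_eq {ι : Type w₁} {p : ℕ} {j : ι × List ℕ} {M : ℕ}
    {atoms : List (TransferIndex ι × List ℕ)} (h : TransferRel p j M atoms) :
    ∀ a ∈ atoms, a.2.length = (Sum.elim (fun _ : Unit => p) (Sum.elim
      (fun s : Unit × List ℕ => p + s.2.sum) (Sum.elim (fun s : Unit × List ℕ => 0 + s.2.sum)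
        (fun s : ι × List ℕ => p + s.2.sum)))) a.1 ∧ ∀ v ∈ a.2, v < M := by
  obtain ⟨⟨c, l⟩, h1, h2, -, -, -, h3, rfl⟩ := h
  refine fun a ha => ⟨?_, h3 a ha⟩
  simp only at h1 h2
  simp only [transferAtoms, List.mem_cons, List.mem_flatMap, List.not_mem_nil, or_false] at ha
  rcases ha with rfl | rfl | ⟨t, ht, rfl | rfl | rfl⟩
  · exact h1
  · simp [h1, List.length_flatMap]
  · exact h2 t ht
  · simp [h2 t ht]
  · simp [h2 t ht, h1]

variable {L : FirstOrder.Language.{u₁, v₁}} [ComputableLanguage L] {ι : Type w₁} [Primcodable ι]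
  {p : ℕ}

/-- The formulas which say of `z₁, …, z_k` that `z_j = c_j ++ x_j` with `φ(c_j)` and
`dom_{c_j}(x_j)`, and that there are `c` and `y_1, …, y_k` with `φ(c)`, `F(c_j, c, x_j, y_j)` and
`Θ_c(y_1, …, y_k)`. -/
def transfer (φ : SigmaOneFormula L p) (dom : GenSigmaOneSeq L Unit p)
    (F : GenSigmaOneSeq L Unit 0) (Θ : GenSigmaOneSeq L ι p) : GenSigmaOneSeq L ι 0 :=
  (φ.sum (dom.sum (F.sum Θ))).query (fun s => 0 + s.2.sum) (TransferRel p)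
    (rePred_transferRel ι p) fun _ _ _ h => h.sum_le

theorem realize_transfer {φ : SigmaOneFormula L p} {dom : GenSigmaOneSeq L Unit p}
    {F : GenSigmaOneSeq L Unit 0} {Θ : GenSigmaOneSeq L ι p} {B : Type w₂} [L.Structure B] (i : ι)
    (zs : List (List B)) :
    (transfer φ dom F Θ).Realize (i, zs.map List.length) zs.flatten ↔
      ∃ (c : List B) (l : List (List B × List B × List B)),
        zs = l.map (fun t => t.1 ++ t.2.1) ∧ φ.Realize () c ∧
        Θ.Realize (i, l.map fun t => t.2.2.length) (c ++ l.flatMap fun t => t.2.2) ∧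
        ∀ t ∈ l, φ.Realize () t.1 ∧ dom.Realize ((), [t.2.1.length]) (t.1 ++ t.2.1) ∧
          F.Realize ((), [p, p, t.2.1.length, t.2.2.length]) (t.1 ++ c ++ t.2.1 ++ t.2.2) := by
  rw [transfer, SigmaOneSeq.realize_query fun _ _ _ h => h.length_eq]
  constructor
  · rintro ⟨-, M, _, ⟨⟨vc, vl⟩, hc, hp, hlen, hrange, hM, hlt, rfl⟩, z, rfl, hz, hr⟩
    simp only at hc hp hlen hrange hM
    simp only [transferAtoms, List.forall_mem_cons, List.forall_mem_flatMap, List.not_mem_nil,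
      IsEmpty.forall_iff, implies_true, and_true] at hr hlt
    obtain ⟨hr1, hr2, hr3⟩ := hr
    obtain ⟨hlt1, hlt2, hlt3⟩ := hlt
    have hltx : ∀ t ∈ vl, ∀ v ∈ t.2.1, v < z.length := fun t ht v hv =>
      (hlt3 t ht).2.1 v (List.mem_append_right _ hv)
    have hlty : ∀ t ∈ vl, ∀ v ∈ t.2.2, v < z.length := fun t ht v hv =>
      (hlt3 t ht).2.2 v (List.mem_append_right _ hv)
    refine ⟨vals z vc, vl.map (vals₃ z), ?_, hr1, ?_, ?_⟩
    -- The formula sees only the concatenation of the `z_j`; the prescribed lengths recover the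
    -- individual tuples.
    · rw [List.eq_iff_flatten_eq]
      constructor
      · have h1 : zs.flatten.length = (vl.flatMap fun t => t.1 ++ t.2.1).length := by
          rw [List.length_flatMap, hlen, List.length_flatten]
        have h2 := vals_range' (pre := []) hz
        rw [List.length_nil, h1, ← List.range_eq_range', ← hrange, vals_flatMap] at h2
        rw [← h2, List.map_map, List.flatMap_def]
        simp [vals₃, vals_append, Function.comp_def]
      · rw [← hlen, List.map_map, List.map_map]
        refine List.map_congr_left fun t ht => ?_
        simp [vals₃, length_vals (hlt3 t ht).1, length_vals (hltx t ht)]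
    · have h1 : ((vl.map (vals₃ z)).map fun t => t.2.2.length) = vl.map fun t => t.2.2.length := by
        rw [List.map_map]
        exact List.map_congr_left fun t ht => length_vals (hlty t ht)
      rw [h1, List.flatMap_map]
      rw [vals_append, vals_flatMap] at hr2
      exact hr2
    · rw [List.forall_mem_map]
      intro t ht
      obtain ⟨h1, h2, h3⟩ := hr3 t ht
      simp only [vals_append] at h2 h3
      simp only [vals₃, length_vals (hltx t ht), length_vals (hlty t ht)]
      exact ⟨h1, h2, h3⟩
  · rintro ⟨c, l, rfl, hc, hΘ, hl⟩
    have hflat : (l.map fun t => t.1 ++ t.2.1).flatten = l.flatMap fun t => t.1 ++ t.2.1 :=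
      (List.flatMap_def ..).symm
    rw [hflat]
    refine ⟨by simp [List.length_flatMap, Function.comp_def], ?_⟩
    -- The satisfying assignment lists the given blocks `c_j ++ x_j`, then `c`, then all the `y_j`.
    set z := (l.flatMap fun t => t.1 ++ t.2.1) ++ c ++ l.flatMap fun t => t.2.2 with hz
    have hpre : (l.flatMap fun t => t.1 ++ t.2.1) <+: z := by
      rw [hz, List.append_assoc]
      exact List.prefix_append _ _
    obtain ⟨vl, hvl, hlt, hrange⟩ := exists_vals₃_eq (z := z) (pre := []) l hpre (by
      intro t ht a ha
      rw [hz]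
      exact List.mem_append_right _ (List.mem_flatMap.2 ⟨t, ht, ha⟩))
    obtain ⟨vc, hvc, hcl⟩ := exists_vals_eq (z := z) (y := c) (by
      intro a ha
      rw [hz]
      exact List.mem_append_left _ (List.mem_append_right _ ha))
    clear_value z
    subst hvl hvc
    have hl1 : ∀ t ∈ vl, ∀ v ∈ t.1, v < z.length := fun t ht v hv => hlt t ht v (by simp [hv])
    have hl2 : ∀ t ∈ vl, ∀ v ∈ t.2.1, v < z.length := fun t ht v hv => hlt t ht v (by simp [hv])
    have hl3 : ∀ t ∈ vl, ∀ v ∈ t.2.2, v < z.length := fun t ht v hv => hlt t ht v (by simp [hv])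
    have hlen : ((vl.map (vals₃ z)).map fun t => (t.1 ++ t.2.1).length) =
        vl.map fun t => (t.1 ++ t.2.1).length := by
      rw [List.map_map]
      refine List.map_congr_left fun t ht => ?_
      simp [vals₃, length_vals (hl1 t ht), length_vals (hl2 t ht)]
    have hlen' : ((vl.map (vals₃ z)).flatMap fun t => t.1 ++ t.2.1).length =
        (vl.flatMap fun t => t.1 ++ t.2.1).length := by
      rw [List.length_flatMap, hlen, List.length_flatMap]
    rw [List.forall_mem_map] at hl
    refine ⟨z.length, _, ⟨(vc, vl), ?_, ?_, ?_, ?_, ?_, ?_, rfl⟩, z, rfl, hpre, ?_⟩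
    · rw [← length_vals hcl]; exact hc.1
    · intro t ht
      rw [← length_vals (hl1 t ht)]
      exact (hl t ht).1.1
    · rw [← hlen]
      simp [Function.comp_def]
    · rw [List.range_eq_range', ← hlen']
      exact hrange
    · rw [← hlen']
      exact hpre.length_le
    · simp only [transferAtoms, List.forall_mem_cons, List.forall_mem_flatMap, List.not_mem_nil,
        IsEmpty.forall_iff, implies_true, and_true, List.forall_mem_append]
      exact ⟨hcl, ⟨hcl, hl3⟩, fun t ht => ⟨hl1 t ht, ⟨hl1 t ht, hl2 t ht⟩,
        ⟨⟨hl1 t ht, hcl⟩, hl2 t ht⟩, hl3 t ht⟩⟩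
    · simp only [transferAtoms, List.forall_mem_cons, List.forall_mem_flatMap, List.not_mem_nil,
        IsEmpty.forall_iff, implies_true, and_true, vals_append, vals_flatMap]
      refine ⟨hc, ?_, fun t ht => ?_⟩
      · have h1 : ((vl.map (vals₃ z)).map fun t => t.2.2.length) =
            vl.map fun t => t.2.2.length := by
          rw [List.map_map]
          exact List.map_congr_left fun t ht => length_vals (hl3 t ht)
        rw [h1, List.flatMap_map] at hΘ
        exact hΘ
      · have := hl t ht
        simp only [vals₃, length_vals (hl2 t ht), length_vals (hl3 t ht)] at this
        exact this

end Transfer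

end EffInt
namespace EffInt

/-! ### Invariance of `Σ₁` formulas under automorphisms -/

section Automorphisms

variable {L : FirstOrder.Language.{u₁, v₁}} [ComputableLanguage L] {ι : Type w₁} [Primcodable ι]
  {B : Type w₂} [L.Structure B]

theorem SigmaOneSeq.Realize.map_equiv {ar : ι → ℕ} {Φ : SigmaOneSeq L ι ar} {i : ι} {x : List B}
    (h : Φ.Realize i x) (σ : B ≃[L] B) : Φ.Realize i (x.map σ) := by
  obtain ⟨hx, θ, hθ, v, hv, hr⟩ := h
  refine ⟨by simpa using hx, θ, hθ, σ ∘ v, ?_, (StrongHomClass.realize_formula σ θ.2).2 hr⟩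
  rw [← List.map_ofFn]
  exact hv.map σ

theorem GenHolds.map_equiv {p : ℕ} {Θ : GenSigmaOneSeq L ι p} {i : ι} {c : Fin p → B}
    {xs : List (List B)} (h : GenHolds Θ i c xs) (σ : B ≃[L] B) :
    GenHolds Θ i (σ ∘ c) (xs.map (List.map σ)) := by
  have := SigmaOneSeq.Realize.map_equiv h σ
  rw [List.map_append, List.map_ofFn, List.map_flatten] at this
  simpa [GenHolds, Function.comp_def] using this

theorem genHolds_comp_equiv {p : ℕ} (Θ : GenSigmaOneSeq L ι p) (i : ι) (b : Fin p → B)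
    (σ : B ≃[L] B) (xs : List (List B)) :
    GenHolds Θ i (σ ∘ b) xs ↔ GenHolds Θ i b (xs.map (List.map σ.symm)) := by
  constructor
  · intro h
    have := h.map_equiv σ.symm
    rwa [← Function.comp_assoc, show (σ.symm ∘ σ : B → B) = id from
      funext fun a => σ.symm_apply_apply a, Function.id_comp] at this
  · intro h
    have := h.map_equiv σ
    rw [List.map_map] at this
    simpa [Function.comp_def] using this

end Automorphisms

/-! ### Interpretations with moved parameters and along partial maps -/

namespace InterpFormulas

variable {LA : FirstOrder.Language.{u₁, v₁}} {LB : FirstOrder.Language.{u₂, v₂}}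
  [ComputableLanguage LA] [ComputableLanguage LB] [LA.IsRelational] {p : ℕ}
  {B : Type w₂} [LB.Structure B] {A : Type w₁} [LA.Structure A]

/-- Applying `σ.symm` to tuples reduces every clause to the one for `b`. The isomorphism is taken as
an assumption, as the maps `f_{c,b}` provide one. -/
theorem Interprets.comp_equiv {Φ : InterpFormulas LA LB p} {b : Fin p → B}
    (hΦ : Φ.Interprets b A) (σ : B ≃[LB] B) (e : Nonempty (Φ.Model (σ ∘ b) ≃[LA] A)) :
    Φ.Interprets (σ ∘ b) A := by
  have hD : ∀ x, x ∈ Φ.D (σ ∘ b) ↔ x.map σ.symm ∈ Φ.D b :=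
    fun x => genHolds_comp_equiv Φ.dom () b σ [x]
  have hE : ∀ x y, Φ.Eqv (σ ∘ b) x y ↔ Φ.Eqv b (x.map σ.symm) (y.map σ.symm) :=
    fun x y => genHolds_comp_equiv Φ.eqv () b σ [x, y]
  have hN : ∀ x y, Φ.Neqv (σ ∘ b) x y ↔ Φ.Neqv b (x.map σ.symm) (y.map σ.symm) :=
    fun x y => genHolds_comp_equiv Φ.neqv () b σ [x, y]
  have hR : ∀ {n : ℕ} (R : LA.Relations n) (xs : Fin n → List B),
      Φ.Rel (σ ∘ b) R xs ↔ Φ.Rel b R (fun j => (xs j).map σ.symm) := fun R xs => by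
    refine (genHolds_comp_equiv Φ.rel ⟨_, R⟩ b σ (List.ofFn xs)).trans ?_
    rw [List.map_ofFn]
    rfl
  have hR' : ∀ {n : ℕ} (R : LA.Relations n) (xs : Fin n → List B),
      Φ.Nrel (σ ∘ b) R xs ↔ Φ.Nrel b R (fun j => (xs j).map σ.symm) := fun R xs => by
    refine (genHolds_comp_equiv Φ.nrel ⟨_, R⟩ b σ (List.ofFn xs)).trans ?_
    rw [List.map_ofFn]
    rfl
  constructor
  · intro x y h
    rw [hD, hD]
    exact hΦ.eqv_dom _ _ ((hE x y).1 h)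
  · have h := hΦ.eqv_equivalence
    constructor
    · exact fun x => (hE _ _).2 (h.refl ⟨_, (hD _).1 x.2⟩)
    · exact fun {x y} hxy => (hE _ _).2
        (h.symm (x := ⟨_, (hD _).1 x.2⟩) (y := ⟨_, (hD _).1 y.2⟩) ((hE _ _).1 hxy))
    · exact fun {x y z} hxy hyz => (hE _ _).2
        (h.trans (x := ⟨_, (hD _).1 x.2⟩) (y := ⟨_, (hD _).1 y.2⟩) (z := ⟨_, (hD _).1 z.2⟩)
          ((hE _ _).1 hxy) ((hE _ _).1 hyz))
  · intro x y
    rw [hN, hD, hD, hE]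
    exact hΦ.neqv_iff _ _
  · intro n R xs h j
    rw [hD]
    exact hΦ.rel_dom R _ ((hR R xs).1 h) j
  · intro n R xs ys h
    rw [hR, hR]
    exact hΦ.rel_invariant R _ _ fun j => (hE _ _).1 (h j)
  · intro n R xs
    rw [hR', hR]
    simp only [hD]
    exact hΦ.nrel_iff R _
  · exact e

/-- `Model` is a quotient by a bare relation; as `≡` is an equivalence, it coincides with the
equivalence it generates. -/
theorem Interprets.cls_eq_iff {Φ : InterpFormulas LA LB p} {c : Fin p → B}
    (hΦ : Φ.Interprets c A) (x y : Φ.D c) : Φ.cls c x = Φ.cls c y ↔ Φ.Eqv c x y :=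
  Quot.eq.trans hΦ.eqv_equivalence.eqvGen_iff

theorem Interprets.relMap_cls {Φ : InterpFormulas LA LB p} {c : Fin p → B}
    (hΦ : Φ.Interprets c A) {n : ℕ} (R : LA.Relations n) (xs : Fin n → Φ.D c) :
    Structure.RelMap R (fun j => Φ.cls c (xs j)) ↔ Φ.Rel c R (fun j => xs j) := by
  constructor
  · rintro ⟨ys, hys, hr⟩
    exact (hΦ.rel_invariant R _ _ fun j => (hΦ.cls_eq_iff _ _).1 (hys j)).1 hr
  · exact fun h => ⟨xs, fun _ => rfl, h⟩

/-- Formulas which define the pullbacks of equality and of the relations of `N` along a surjective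
partial map `G` onto `N` interpret `N`. -/
theorem interprets_of_partialMap {Φ : InterpFormulas LA LB p} {c : Fin p → B}
    {N : Type*} [LA.Structure N] (G : List B → N → Prop)
    (hG : ∀ z m m', G z m → G z m' → m = m') (hsurj : ∀ m, ∃ z, G z m)
    (hD : ∀ z, z ∈ Φ.D c ↔ ∃ m, G z m)
    (hE : ∀ z z', Φ.Eqv c z z' ↔ ∃ m, G z m ∧ G z' m)
    (hN : ∀ z z', Φ.Neqv c z z' ↔ ∃ m m', G z m ∧ G z' m' ∧ m ≠ m')
    (hR : ∀ {n : ℕ} (R : LA.Relations n) (zs : Fin n → List B),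
      Φ.Rel c R zs ↔ ∃ q : Fin n → N, (∀ j, G (zs j) (q j)) ∧ Structure.RelMap R q)
    (hR' : ∀ {n : ℕ} (R : LA.Relations n) (zs : Fin n → List B),
      Φ.Nrel c R zs ↔ ∃ q : Fin n → N, (∀ j, G (zs j) (q j)) ∧ ¬ Structure.RelMap R q) :
    Φ.Interprets c N := by
  choose g hg using fun z : Φ.D c => (hD z).1 z.2
  have hgE : ∀ x y : Φ.D c, Φ.Eqv c x y ↔ g x = g y := fun x y => by
    rw [hE]
    constructor
    · rintro ⟨m, h1, h2⟩
      rw [hG _ _ _ (hg x) h1, hG _ _ _ (hg y) h2]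
    · exact fun h => ⟨g x, hg x, h ▸ hg y⟩
  refine ⟨?_, ?_, ?_, ?_, ?_, ?_, ?_⟩
  · intro x y h
    obtain ⟨m, h1, h2⟩ := (hE _ _).1 h
    exact ⟨(hD _).2 ⟨m, h1⟩, (hD _).2 ⟨m, h2⟩⟩
  · simp only [hgE]
    exact ⟨fun _ => rfl, fun h => h.symm, fun h h' => h.trans h'⟩
  · intro x y
    rw [hN, hD, hD, hE]
    constructor
    · rintro ⟨m, m', h1, h2, hne⟩
      exact ⟨⟨m, h1⟩, ⟨m', h2⟩, fun ⟨k, h3, h4⟩ =>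
        hne ((hG _ _ _ h1 h3).trans (hG _ _ _ h4 h2))⟩
    · rintro ⟨⟨m, h1⟩, ⟨m', h2⟩, hne⟩
      exact ⟨m, m', h1, h2, fun h => hne ⟨m, h1, h ▸ h2⟩⟩
  · intro n R xs h j
    obtain ⟨q, hq, -⟩ := (hR R xs).1 h
    exact (hD _).2 ⟨_, hq j⟩
  · intro n R xs ys h
    have h' : ∀ q : Fin n → N, (∀ j, G (xs j) (q j)) ↔ ∀ j, G (ys j) (q j) := fun q =>
      forall_congr' fun j => by
        obtain ⟨m, h1, h2⟩ := (hE _ _).1 (h j)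
        exact ⟨fun h3 => hG _ _ _ h1 h3 ▸ h2, fun h3 => hG _ _ _ h2 h3 ▸ h1⟩
    simp only [hR, h']
  · intro n R xs
    rw [hR', hR]
    constructor
    · rintro ⟨q, hq, hr⟩
      refine ⟨fun j => (hD _).2 ⟨_, hq j⟩, fun ⟨q', hq', hr'⟩ => hr ?_⟩
      rwa [show q = q' from funext fun j => hG _ _ _ (hq j) (hq' j)]
    · rintro ⟨hd, hr⟩
      exact ⟨fun j => g ⟨xs j, hd j⟩, fun j => hg ⟨xs j, hd j⟩,
        fun h => hr ⟨_, fun j => hg ⟨xs j, hd j⟩, h⟩⟩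
  -- `≡` is the kernel of `g`, so `g` descends to a bijection of the quotient with `N`.
  · let F : Φ.Model c → N := Quot.lift g fun x y h => (hgE x y).1 h
    have hF : Function.Bijective F := by
      constructor
      · rintro ⟨x⟩ ⟨y⟩ h
        exact Quot.sound ((hgE x y).2 h)
      · intro m
        obtain ⟨z, hz⟩ := hsurj m
        exact ⟨Φ.cls c ⟨z, (hD z).2 ⟨m, hz⟩⟩, hG _ _ _ (hg ⟨z, _⟩) hz⟩
    refine ⟨⟨Equiv.ofBijective F hF, fun f => isEmptyElim f, ?_⟩⟩
    intro n R q
    choose xs hxs using fun j => Quot.exists_rep (q j)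
    obtain rfl : (fun j => Φ.cls c (xs j)) = q := funext hxs
    constructor
    · exact fun h => ⟨xs, fun _ => rfl, (hR R _).2 ⟨_, fun j => hg (xs j), h⟩⟩
    · rintro ⟨ys, hys, hr⟩
      obtain ⟨q', hq', hr'⟩ := (hR R _).1 hr
      convert hr' using 1
      funext j
      change F (Φ.cls c (xs j)) = _
      rw [show Φ.cls c (xs j) = Φ.cls c (ys j) from (hys j).symm]
      exact hG _ _ _ (hg (ys j)) (hq' j)

end InterpFormulas

/-! ### The pooled map and the transferred formulas -/

section Main

theorem mem_orbit_self {L : FirstOrder.Language.{u₂, v₂}} {B : Type w₂} [L.Structure B] {p : ℕ}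
    (b : Fin p → B) : b ∈ orbit L b :=
  ⟨FirstOrder.Language.Equiv.refl L B, rfl⟩

variable {LA : FirstOrder.Language.{u₁, v₁}} {LB : FirstOrder.Language.{u₂, v₂}} [LA.IsRelational]
    [ComputableLanguage LA] [ComputableLanguage LB]
    {A : Type w₁} [LA.Structure A] {B : Type w₂} [LB.Structure B] {p : ℕ}

theorem exists_ofFn_eq {l : List B} (h : l.length = p) : ∃ c : Fin p → B, List.ofFn c = l := by
  subst h
  exact ⟨l.get, List.ofFn_get l⟩

/-- The partial map from finite tuples to the structure with parameters `b`: a tuple `c ++ x`, where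
`c` is in the orbit of `b` and `x` in the domain with parameters `c`, is sent to the image of the
class of `x`. -/
def pooledMap {b : Fin p → B} {Φ : InterpFormulas LA LB p}
    (f : ∀ c d : orbit LB b, Φ.Model c.1 ≃[LA] Φ.Model d.1) (z : List B) (m : Φ.Model b) : Prop :=
  ∃ (c : orbit LB b) (x : Φ.D c.1), z = List.ofFn c.1 ++ x.1 ∧
    f c ⟨b, mem_orbit_self b⟩ (Φ.cls c.1 x) = m

/-- Parameter tuples all have length `p`, so a tuple splits as `c ++ x` in only one way. -/
theorem pooledMap_unique {b : Fin p → B} {Φ : InterpFormulas LA LB p}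
    (f : ∀ c d : orbit LB b, Φ.Model c.1 ≃[LA] Φ.Model d.1) (z : List B) (m m' : Φ.Model b)
    (h : pooledMap f z m) (h' : pooledMap f z m') : m = m' := by
  obtain ⟨⟨c, hc⟩, ⟨x, hx⟩, rfl, rfl⟩ := h
  obtain ⟨⟨d, hd⟩, ⟨y, hy⟩, hz, rfl⟩ := h'
  obtain ⟨h1, rfl⟩ := List.append_inj hz (by simp)
  obtain rfl := List.ofFn_injective h1
  rfl

/-- The hypothesis `hΘ` says that, for every `c` in the orbit, `Θ_c` defines the pullback along
`f_{c,b}` of one and the same property `P` of tuples of `A_b`. This independence of `c` lets the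
formula quantify `c` away. -/
theorem genHolds_transfer {b : Fin p → B} {Φ : InterpFormulas LA LB p} {φ : SigmaOneFormula LB p}
    (hφ : ∀ c : Fin p → B, φ.Realize () (List.ofFn c) ↔ c ∈ orbit LB b)
    {F : GenSigmaOneSeq LB Unit 0} {f : ∀ c d : orbit LB b, Φ.Model c.1 ≃[LA] Φ.Model d.1}
    (hf : ∀ (c d : orbit LB b) (x : Φ.D c.1) (y : Φ.D d.1),
      f c d (Φ.cls c.1 x) = Φ.cls d.1 y ↔ quaternary F c.1 d.1 x.1 y.1)
    (hid : ∀ c : orbit LB b, f c c = FirstOrder.Language.Equiv.refl LA (Φ.Model c.1))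
    (hcomp : ∀ c d e : orbit LB b, (f d e).comp (f c d) = f c e)
    {ι : Type*} [Primcodable ι] (Θ : GenSigmaOneSeq LB ι p) (i : ι)
    (P : List (Φ.Model b) → Prop) (zs : List (List B))
    (hΘ : ∀ (c : orbit LB b) (ys : List (List B)), ys.length = zs.length → (GenHolds Θ i c.1 ys ↔
      ∃ ys' : List (Φ.D c.1), ys = ys'.map Subtype.val ∧
        P (ys'.map fun y => f c ⟨b, mem_orbit_self b⟩ (Φ.cls c.1 y)))) :
    GenHolds (transfer φ Φ.dom F Θ) i (Fin.elim0 : Fin 0 → B) zs ↔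
      ∃ ms, List.Forall₂ (pooledMap f) zs ms ∧ P ms := by
  set b₀ : orbit LB b := ⟨b, mem_orbit_self b⟩
  have hgen : ∀ (c : Fin p → B) (l : List (List B × List B × List B)),
      Θ.Realize (i, l.map fun t => t.2.2.length) (List.ofFn c ++ l.flatMap fun t => t.2.2) ↔
        GenHolds Θ i c (l.map fun t => t.2.2) := by
    intro c l
    simp [GenHolds, Function.comp_def, List.flatMap_def]
  have hdom : ∀ (c : Fin p → B) (x : List B),
      Φ.dom.Realize ((), [x.length]) (List.ofFn c ++ x) ↔ x ∈ Φ.D c := by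
    intro c x
    simp [InterpFormulas.D, GenHolds]
  have hquat : ∀ (c d : Fin p → B) (x y : List B), F.Realize ((), [p, p, x.length, y.length])
      (List.ofFn c ++ List.ofFn d ++ x ++ y) ↔ quaternary F c d x y := by
    intro c d x y
    simp [quaternary, GenHolds]
  have hstart : GenHolds (transfer φ Φ.dom F Θ) i (Fin.elim0 : Fin 0 → B) zs ↔
      (transfer φ Φ.dom F Θ).Realize (i, zs.map List.length) zs.flatten := by
    simp [GenHolds]
  rw [hstart, realize_transfer]
  constructor
  · rintro ⟨c, l, rfl, hc, hr, hl⟩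
    obtain ⟨c, rfl⟩ := exists_ofFn_eq hc.1
    have hc' := (hφ c).1 hc
    rw [hgen, hΘ ⟨c, hc'⟩ _ (by simp)] at hr
    obtain ⟨ys, hys, hP⟩ := hr
    refine ⟨_, ?_, hP⟩
    clear hP hΘ hstart
    induction l generalizing ys with
    | nil =>
      obtain rfl : ys = [] := List.map_eq_nil_iff.1 hys.symm
      exact .nil
    | cons t l ih =>
      cases ys with
      | nil => simp at hys
      | cons y ys =>
        simp only [List.map_cons, List.cons.injEq] at hys ⊢
        refine .cons ?_ (ih (fun t ht => hl t (List.mem_cons_of_mem _ ht)) ys hys.2)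
        obtain ⟨h1, h2, h3⟩ := hl t List.mem_cons_self
        obtain ⟨d, hd⟩ := exists_ofFn_eq h1.1
        rw [← hd] at h1 h2 h3 ⊢
        have hd' := (hφ d).1 h1
        rw [hdom] at h2
        rw [hquat, hys.1] at h3
        refine ⟨⟨d, hd'⟩, ⟨t.2.1, h2⟩, rfl, ?_⟩
        -- Here `F` gives `f_{d,c}[x] = [y]`, and the cocycle identity `f_{c,b} ∘ f_{d,c} = f_{d,b}`
        -- shows that `d ++ x` and `y` have the same image in `A_b`.
        rw [← (hf ⟨d, hd'⟩ ⟨c, hc'⟩ ⟨t.2.1, h2⟩ y).2 h3, ← hcomp ⟨d, hd'⟩ ⟨c, hc'⟩ b₀]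
        rfl
  · rintro ⟨ms, hG, hP⟩
    -- For the converse the common parameter is `b` itself, and `y_j` is any representative of
    -- `f_{c_j,b}[x_j]`.
    have key : ∃ (l : List (List B × List B × List B)) (ys : List (Φ.D b₀.1)),
        zs = l.map (fun t => t.1 ++ t.2.1) ∧ l.map (fun t => t.2.2) = ys.map Subtype.val ∧
        ys.map (fun y => f b₀ b₀ (Φ.cls b₀.1 y)) = ms ∧
        ∀ t ∈ l, φ.Realize () t.1 ∧ Φ.dom.Realize ((), [t.2.1.length]) (t.1 ++ t.2.1) ∧
          F.Realize ((), [p, p, t.2.1.length, t.2.2.length])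
            (t.1 ++ List.ofFn b ++ t.2.1 ++ t.2.2) := by
      clear hP hΘ hstart
      induction hG with
      | nil => exact ⟨[], [], by simp⟩
      | @cons z m zs ms h _ ih =>
        obtain ⟨l, ys, rfl, h2, rfl, h4⟩ := ih
        obtain ⟨c, x, rfl, rfl⟩ := h
        obtain ⟨y, hy⟩ := Quot.exists_rep (f c b₀ (Φ.cls c.1 x))
        have hy' : f b₀ b₀ (Φ.cls b₀.1 y) = f c b₀ (Φ.cls c.1 x) := by
          rw [hid]
          exact hy
        refine ⟨(List.ofFn c.1, x.1, y.1) :: l, y :: ys, rfl, ?_, ?_,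
          List.forall_mem_cons.2 ⟨⟨(hφ _).2 c.2, (hdom _ _).2 x.2, (hquat _ _ _ _).2 ?_⟩, h4⟩⟩
        · simp [h2]
        · rw [List.map_cons, hy']
        · exact (hf c b₀ x y).1 hy.symm
    obtain ⟨l, ys, rfl, h2, rfl, h4⟩ := key
    refine ⟨List.ofFn b, l, rfl, (hφ b).2 b₀.2, ?_, h4⟩
    rw [hgen]
    exact (hΘ b₀ _ (by simp)).2 ⟨ys, h2, hP⟩

/-- The version for tuples indexed by `Fin n`, as needed for the relation symbols. -/
theorem genHolds_transfer_ofFn {b : Fin p → B} {Φ : InterpFormulas LA LB p}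
    {φ : SigmaOneFormula LB p}
    (hφ : ∀ c : Fin p → B, φ.Realize () (List.ofFn c) ↔ c ∈ orbit LB b)
    {F : GenSigmaOneSeq LB Unit 0} {f : ∀ c d : orbit LB b, Φ.Model c.1 ≃[LA] Φ.Model d.1}
    (hf : ∀ (c d : orbit LB b) (x : Φ.D c.1) (y : Φ.D d.1),
      f c d (Φ.cls c.1 x) = Φ.cls d.1 y ↔ quaternary F c.1 d.1 x.1 y.1)
    (hid : ∀ c : orbit LB b, f c c = FirstOrder.Language.Equiv.refl LA (Φ.Model c.1))
    (hcomp : ∀ c d e : orbit LB b, (f d e).comp (f c d) = f c e)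
    {ι : Type*} [Primcodable ι] (Θ : GenSigmaOneSeq LB ι p) (i : ι) {n : ℕ}
    (T : (Fin n → Φ.Model b) → Prop)
    (hT : ∀ (c : orbit LB b) (xs : Fin n → List B), GenHolds Θ i c.1 (List.ofFn xs) ↔
      ∃ ys : Fin n → Φ.D c.1, (xs = fun j => (ys j).1) ∧
        T fun j => f c ⟨b, mem_orbit_self b⟩ (Φ.cls c.1 (ys j)))
    (zs : Fin n → List B) :
    GenHolds (transfer φ Φ.dom F Θ) i (Fin.elim0 : Fin 0 → B) (List.ofFn zs) ↔
      ∃ q : Fin n → Φ.Model b, (∀ j, pooledMap f (zs j) (q j)) ∧ T q := by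
  refine (genHolds_transfer hφ hf hid hcomp Θ i (fun ms => ∃ q, ms = List.ofFn q ∧ T q)
    (List.ofFn zs) ?_).trans ?_
  · intro c ys hys
    rw [List.length_ofFn] at hys
    obtain ⟨xs, rfl⟩ := exists_ofFn_eq hys
    refine (hT c xs).trans ⟨?_, ?_⟩
    · rintro ⟨ys, rfl, h⟩
      exact ⟨List.ofFn ys, (List.map_ofFn ..).symm, _, List.map_ofFn .., h⟩
    · rintro ⟨l, h, q, h', hq⟩
      obtain ⟨ys, rfl⟩ := exists_ofFn_eq (l := l) (p := n)
        (by simpa using congrArg List.length h')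
      rw [List.map_ofFn] at h h'
      exact ⟨ys, List.ofFn_injective h, by rwa [← List.ofFn_injective h'] at hq⟩
  · have h : ∀ q : Fin n → Φ.Model b,
        List.Forall₂ (pooledMap f) (List.ofFn zs) (List.ofFn q) ↔
          ∀ j, pooledMap f (zs j) (q j) := by
      intro q
      rw [List.forall₂_iff_get]
      simp only [List.length_ofFn, List.get_ofFn, true_and]
      exact ⟨fun h j => h j j.2 j.2, fun h j hj _ => h ⟨j, hj⟩⟩
    constructor
    · rintro ⟨_, hm, q, rfl, hq⟩
      exact ⟨q, (h q).1 hm, hq⟩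
    · rintro ⟨q, hm, hq⟩
      exact ⟨_, (h q).2 hm, q, rfl, hq⟩

end Main

end EffInt

/-! ### The interpretation without parameters -/

theorem mainTheorem4 {LA : FirstOrder.Language.{u₁, v₁}} {LB : FirstOrder.Language.{u₂, v₂}} [LA.IsRelational]
    [EffInt.ComputableLanguage LA] [EffInt.ComputableLanguage LB]
    {A : Type w₁} [LA.Structure A] {B : Type w₂} [LB.Structure B]
    {p : ℕ} (b : Fin p → B) (Φ : EffInt.InterpFormulas LA LB p) (hΦ : Φ.Interprets b A)
    (φ : EffInt.SigmaOneFormula LB p)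
    (hφ : ∀ c : Fin p → B, φ.Realize () (List.ofFn c) ↔ c ∈ EffInt.orbit LB b)
    (F : EffInt.GenSigmaOneSeq LB Unit 0)
    (hFinv : ∀ c ∈ EffInt.orbit LB b, ∀ d ∈ EffInt.orbit LB b, ∀ x x' y y' : List B,
      Φ.Eqv c x x' → Φ.Eqv d y y' →
        (EffInt.quaternary F c d x y ↔ EffInt.quaternary F c d x' y'))
    (f : ∀ c d : EffInt.orbit LB b, Φ.Model c.1 ≃[LA] Φ.Model d.1)
    (hf : ∀ (c d : EffInt.orbit LB b) (x : Φ.D c.1) (y : Φ.D d.1),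
      f c d (Φ.cls c.1 x) = Φ.cls d.1 y ↔
        EffInt.quaternary F c.1 d.1 x.1 y.1)
    (hid : ∀ c : EffInt.orbit LB b, f c c = FirstOrder.Language.Equiv.refl LA (Φ.Model c.1))
    (hcomp : ∀ c d e : EffInt.orbit LB b, (f d e).comp (f c d) = f c e) :
    EffInt.EffectivelyInterpreted LA LB A B := by
  obtain ⟨e⟩ := hΦ.iso
  let b₀ : EffInt.orbit LB b := ⟨b, EffInt.mem_orbit_self b⟩
  have hint : ∀ c : EffInt.orbit LB b, Φ.Interprets c.1 A := by
    rintro ⟨_, σ, rfl⟩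
    -- The isomorphism `A_c ≅ A` is `f_{c,b}` followed by `A_b ≅ A`.
    exact hΦ.comp_equiv σ ⟨e.comp (f ⟨_, σ, rfl⟩ b₀)⟩
  have hinj : ∀ (c : EffInt.orbit LB b) (x y : Φ.D c.1),
      f c b₀ (Φ.cls c.1 x) = f c b₀ (Φ.cls c.1 y) ↔ Φ.Eqv c.1 x y := fun c x y => by
    rw [(f c b₀).injective.eq_iff, (hint c).cls_eq_iff]
  have hrel : ∀ (c : EffInt.orbit LB b) {n : ℕ} (R : LA.Relations n) (xs : Fin n → Φ.D c.1),
      Structure.RelMap R (fun j => f c b₀ (Φ.cls c.1 (xs j))) ↔ Φ.Rel c.1 R fun j => xs j :=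
    fun c n R xs => ((f c b₀).map_rel R _).trans ((hint c).relMap_cls R xs)
  let Ψ : EffInt.InterpFormulas LA LB 0 :=
    ⟨EffInt.transfer φ Φ.dom F Φ.dom, EffInt.transfer φ Φ.dom F Φ.eqv,
      EffInt.transfer φ Φ.dom F Φ.neqv, EffInt.transfer φ Φ.dom F Φ.rel,
      EffInt.transfer φ Φ.dom F Φ.nrel⟩
  -- `A` enters the definition of an interpretation only through its isomorphism type, so it may be
  -- replaced by `A_b`.
  suffices h : Ψ.Interprets (Fin.elim0 : Fin 0 → B) (Φ.Model b) by
    obtain ⟨e'⟩ := h.iso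
    exact ⟨Ψ, { h with iso := ⟨e.comp e'⟩ }⟩
  refine EffInt.InterpFormulas.interprets_of_partialMap (EffInt.pooledMap f)
    (EffInt.pooledMap_unique f) ?_ ?_ ?_ ?_ ?_ ?_
  · rintro ⟨x⟩
    refine ⟨_, b₀, x, rfl, ?_⟩
    rw [hid]
    rfl
  · intro z
    -- For the domain, `P` imposes nothing on the single image. For `≡` and its complement, `P` asks
    -- that the two images be equal or distinct.
    refine (EffInt.genHolds_transfer hφ hf hid hcomp Φ.dom () (fun ms => ∃ m, ms = [m]) [z]
      ?_).trans ?_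
    · intro c ys hys
      obtain ⟨y, rfl⟩ := List.length_eq_one_iff.1 hys
      constructor
      · exact fun h => ⟨[⟨y, h⟩], rfl, _, rfl⟩
      · rintro ⟨ys', h, m, h'⟩
        obtain ⟨y', rfl⟩ := List.length_eq_one_iff.1 (by simpa using congrArg List.length h')
        simp only [List.map_cons, List.map_nil, List.cons.injEq, and_true] at h
        subst h
        exact y'.2
    · simp
  · intro z z'
    refine (EffInt.genHolds_transfer hφ hf hid hcomp Φ.eqv () (fun ms => ∃ m, ms = [m, m]) [z, z']
      ?_).trans ?_
    · intro c ys hys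
      obtain ⟨y, y', rfl⟩ := List.length_eq_two.1 hys
      constructor
      · intro h
        obtain ⟨h1, h2⟩ := (hint c).eqv_dom _ _ h
        exact ⟨[⟨y, h1⟩, ⟨y', h2⟩], rfl, f c b₀ (Φ.cls c.1 ⟨y, h1⟩),
          congrArg (fun k => [f c b₀ (Φ.cls c.1 ⟨y, h1⟩), k])
            ((hinj c ⟨y, h1⟩ ⟨y', h2⟩).2 h).symm⟩
      · rintro ⟨ys', h, m, h'⟩
        obtain ⟨x, x', rfl⟩ := List.length_eq_two.1 (by simpa using congrArg List.length h')
        simp only [List.map_cons, List.map_nil, List.cons.injEq, and_true] at h h'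
        obtain ⟨rfl, rfl⟩ := h
        exact (hinj c x x').1 (h'.1.trans h'.2.symm)
    · simp
  · intro z z'
    refine (EffInt.genHolds_transfer hφ hf hid hcomp Φ.neqv ()
      (fun ms => ∃ m m', ms = [m, m'] ∧ m ≠ m') [z, z'] ?_).trans ?_
    · intro c ys hys
      obtain ⟨y, y', rfl⟩ := List.length_eq_two.1 hys
      refine ((hint c).neqv_iff y y').trans ?_
      constructor
      · rintro ⟨h1, h2, h⟩
        exact ⟨[⟨y, h1⟩, ⟨y', h2⟩], rfl, _, _, rfl, fun h' => h ((hinj c ⟨y, h1⟩ ⟨y', h2⟩).1 h')⟩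
      · rintro ⟨ys', h, m, m', h', hne⟩
        obtain ⟨x, x', rfl⟩ := List.length_eq_two.1 (by simpa using congrArg List.length h')
        simp only [List.map_cons, List.map_nil, List.cons.injEq, and_true] at h h'
        obtain ⟨rfl, rfl⟩ := h
        obtain ⟨rfl, rfl⟩ := h'
        exact ⟨x.2, x'.2, fun h => hne ((hinj c x x').2 h)⟩
    · constructor
      · rintro ⟨_, h, m, m', rfl, hne⟩
        simp only [List.forall₂_cons, List.forall₂_nil_left_iff, and_true] at h
        exact ⟨m, m', h.1, h.2, hne⟩
      · rintro ⟨m, m', h1, h2, hne⟩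
        exact ⟨_, .cons h1 (.cons h2 .nil), m, m', rfl, hne⟩
  · intro n R zs
    refine EffInt.genHolds_transfer_ofFn hφ hf hid hcomp Φ.rel ⟨n, R⟩
      (fun q => Structure.RelMap R q) (fun c xs => ⟨fun h => ?_, ?_⟩) zs
    · exact ⟨fun j => ⟨xs j, (hint c).rel_dom R xs h j⟩, rfl, (hrel c R _).2 h⟩
    · rintro ⟨ys, rfl, h⟩
      exact (hrel c R ys).1 h
  · intro n R zs
    refine EffInt.genHolds_transfer_ofFn hφ hf hid hcomp Φ.nrel ⟨n, R⟩
      (fun q => ¬ Structure.RelMap R q) (fun c xs => ((hint c).nrel_iff R xs).trans ?_) zs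
    constructor
    · rintro ⟨h, h'⟩
      exact ⟨fun j => ⟨xs j, h j⟩, rfl, fun h'' => h' ((hrel c R _).1 h'')⟩
    · rintro ⟨ys, rfl, h⟩
      exact ⟨fun j => (ys j).2, fun h' => h ((hrel c R ys).2 h')⟩
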